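/- Let $\log$ denote the logarithm to base $2$. For an activation function $\sigma:\mathbb R\to\mathbb R$, a $\sigma$-network with input dimension $d_x$ and $m\ge 0$ hidden layers of dimensions $d_1,\dots,d_m\ge 1$ is the family of functions $f_\theta=t_m\circ\sigma\circ t_{m-1}\circ\cdots\circ\sigma\circ t_0:\mathbb R^{d_x}\to\mathbb R$, where $\sigma$ acts coordinatewise, $t_\ell:\mathbb R^{d_\ell}\to\mathbb R^{d_{\ell+1}}$ is an affine map (with $d_0=d_x$ and $d_{m+1}=1$), and $\theta$ collects all weights and biases; its number of parameters is the number of all these weights and biases, $\sum_{\ell=0}^{m}(d_\ell+1)d_{\ell+1}$. Call $\sigma$ sigmoidal if $\lim_{x\to-\infty}\sigma(x)$ and $\lim_{x\to\infty}\sigma(x)$ exist in $\mathbb R$ and are different, and there is $z\in\mathbb R$ such that $\sigma$ is continuously differentiable at $z$ with $\sigma'(z)\neq 0$. A set $\mathcal X\subset\mathbb R^{d_x}$ is $\Delta$-separated if $$\sup_{x,x'\in\mathcal X,\,x\ne x'}\|x-x'\|_2<\Delta\cdot\inf_{x,x'\in\mathcal X,\,x\ne x'}\|x-x'\|_2$$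 (with $\sup\emptyset=0$ and $\inf\emptyset=\infty$ in $[0,\infty]$, so a one-point set is $\Delta$-separated for every $\Delta>0$). **Theorem.** There is a universal constant $K>0$ such that the following holds for every $\sigma$ that is sigmoidal or equal to $\mathrm{ReLU}:x\mapsto\max\{x,0\}$, all integers $C,N,d_x\ge1$, all $w\in[2/3,1]$ and all real $\Delta\ge1$. There is a $\sigma$-network architecture (a choice of hidden layer dimensions $d_1,\dots,d_m$) with $$m\le K\Big(\log d_x+\log\Delta+\frac{N^{2-2w}}{1+(1.5w-1)\log N}\log C\Big)$$ hidden layers and at most $$K\Big(d_x+\log\Delta+N^w+N^{1-w/2}\log C\Big)$$ parameters that can memorize any $\Delta$-separated set of $N$ input-label pairs in dimension $d_x$ with $C$ classes; that is, for every $\Delta$-separated $\mathcal X\subset\mathbb R^{d_x}$ with $|\mathcal X|=N$, every label function $y:\mathcal X\to\{0,\dots,C-1\}$ and every $\varepsilon>0$, there are parameters $\theta$ of this architecture with $|f_\theta(x)-y(x)|\le\varepsilon$ for all $x\in\mathcal X$. -/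

import Mathlib

/-- The rectified linear unit `x ↦ max{x, 0}`. -/
noncomputable def relu (x : ℝ) : ℝ := max x 0

/-- Sigmoidal activation functions: both limits at `±∞` exist and are different, and there is a
point `z` at which the function is continuously differentiable (it is differentiable near `z` and
its derivative is continuous at `z`) with non-zero derivative. -/
def IsSigmoidal (σ : ℝ → ℝ) : Prop :=
  (∃ a b : ℝ, Filter.Tendsto σ Filter.atBot (nhds a) ∧ Filter.Tendsto σ Filter.atTop (nhds b) ∧
    a ≠ b) ∧
  ∃ z : ℝ, (∀ᶠ x in nhds z, DifferentiableAt ℝ σ x) ∧ ContinuousAt (deriv σ) z ∧ deriv σ z ≠ 0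

/-- The parameters (all weights and biases) of a fully-connected network with input dimension `n`,
hidden layer dimensions `ds` (first hidden layer first) and output dimension `1`. -/
def NetParams : ℕ → List ℕ → Type
  | n, [] => (Fin n → ℝ) × ℝ
  | n, d :: ds => (Matrix (Fin d) (Fin n) ℝ × (Fin d → ℝ)) × NetParams d ds

/-- The number of weights and biases of the network architecture with input dimension `n`,
hidden layer dimensions `ds` and output dimension `1`. -/
def numParams : ℕ → List ℕ → ℕ
  | n, [] => n + 1
  | n, d :: ds => (d * n + d) + numParams d ds

/-- The function `t_{L-1} ∘ σ ∘ ⋯ ∘ t_1 ∘ σ ∘ t_0` computed by a network with parameters `θ`: an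
affine map, then `σ` in every coordinate, for each hidden layer, and a last affine map to `ℝ`. -/
def netEval (σ : ℝ → ℝ) : (n : ℕ) → (ds : List ℕ) → NetParams n ds → (Fin n → ℝ) → ℝ
  | _, [], θ, x => (∑ j, θ.1 j * x j) + θ.2
  | _, d :: ds, θ, x => netEval σ d ds θ.2 (fun i => σ ((θ.1.1.mulVec x) i + θ.1.2 i))

/-- `X` is `Δ`-separated: the supremum of the distances between distinct points is smaller than `Δ`
times their infimum. Both are taken in `[0, ∞]`, so that for a set with at most one point they are
`0` and `∞`. -/
def IsSeparated {dx : ℕ} (Δ : ℝ) (X : Set (EuclideanSpace ℝ (Fin dx))) : Prop :=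
  (⨆ (x ∈ X) (x' ∈ X) (_ : x ≠ x'), edist x x') <
    ENNReal.ofReal Δ * ⨅ (x ∈ X) (x' ∈ X) (_ : x ≠ x'), edist x x'

/-- The `σ` network architecture with input dimension `dx` and hidden layer dimensions `ds` can
memorize the pairs `(x, y x)`, `x ∈ X`, with labels `y x ∈ {0, …, C - 1}`: for every `ε > 0` some
choice of its parameters fits all of them within `ε`. -/
def CanMemorize (σ : ℝ → ℝ) (dx : ℕ) (ds : List ℕ) {C : ℕ}
    (X : Finset (EuclideanSpace ℝ (Fin dx))) (y : X → Fin C) : Prop :=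
  ∀ ε : ℝ, 0 < ε → ∃ θ : NetParams dx ds, ∀ x : X,
    |netEval σ dx ds θ (fun j => (x : EuclideanSpace ℝ (Fin dx)) j) - ((y x : ℕ) : ℝ)| ≤ ε

open Filter Topology

/-! Two neurons with an admissible activation approximate a step function and also the identity, so
it suffices to build an exact network of step units that carries a state in `ℝ³` (`StepChain`). A
bottleneck of width 6 after each step layer keeps the parameter count linear in the number of step
units.

A counting argument gives a linear form under which the points are at distance at least 1 and lie in
an interval of length `O(d² Δ N²)` (`exists_projection`). A step layer can cut the line into pieces
and translate each piece separately. Translations that keep all points 1-separated exist as soon as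
more are allowed than the pairs of points can forbid (`exists_class_shift`). With one step unit this
roughly halves the interval, so `O(log d + log Δ)` layers reach length `O(N²)`
(`StepChain.halving`). One further layer with `O(N^w)` units reaches `O(N^(2-w))`
(`exists_hash_layer`).

The integer parts are now distinct. The interval is cut into `O(N^w)` blocks of length about `D =
N^(2-2w)`, and the labels of a block are the digits of one real number. A point loads the word of
its block and its position there, then peels off the digits one layer at a time and keeps those at
its position (`StepChain.lookup`). A base `Q ≈ N^(1.5w-1)` costs `2Q` units per digit and yields
about `k = 1 + (1.5w-1) log N` bits. So `O(1 + D log C / k)` layers suffice, and the digits cost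
`O(N^w + D Q log C)` units, where `D Q ≈ N^(1-w/2)` (`exists_lookup_chain`). -/

/-! ### Step and identity units as limits of two neurons -/

/-- The unit step function `x ↦ 1[x ≥ 0]`. -/
noncomputable def heaviside (x : ℝ) : ℝ := if 0 ≤ x then 1 else 0

/-- `g` is a limit of affine combinations of two neurons with activation `σ`; the convergence is
robust under small perturbations of the argument. -/
def TwoNeuronLimit (σ g : ℝ → ℝ) : Prop :=
  ∃ (a b c : ℕ → Fin 2 → ℝ) (c₀ : ℕ → ℝ), ∀ x : ℝ,
    Tendsto (fun p : ℕ × ℝ => ∑ s, c p.1 s * σ (a p.1 s * p.2 + b p.1 s) + c₀ p.1)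
      (atTop.curry (𝓝 x)) (𝓝 (g x))

/-- In the curried filter the neighbourhood of `x` may depend on `n`, so pointwise convergence and
continuity of each late term are enough; no uniformity is needed. -/
theorem tendsto_curry_of_continuousAt {f : ℕ → ℝ → ℝ} {x L : ℝ}
    (hc : ∀ᶠ n in atTop, ContinuousAt (f n) x) (h : Tendsto (fun n => f n x) atTop (𝓝 L)) :
    Tendsto (fun p : ℕ × ℝ => f p.1 p.2) (atTop.curry (𝓝 x)) (𝓝 L) := by
  rw [tendsto_nhds]
  intro U hU hL
  rw [mem_curry_iff]
  filter_upwards [hc, h (hU.mem_nhds hL)] with n hn hx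
  exact hn (hU.mem_nhds hx)

/-- The shift `n` settles the jump point: at `x = 0` the argument still tends to `+∞`, matching
`heaviside 0 = 1`, while for `x < 0` the term `n² x` dominates it. -/
theorem tendsto_steep_atTop {x : ℝ} (hx : 0 ≤ x) :
    Tendsto (fun p : ℕ × ℝ => (p.1 : ℝ) ^ 2 * p.2 + p.1) (atTop.curry (𝓝 x)) atTop := by
  rw [tendsto_atTop]
  intro M
  rw [eventually_curry_iff]
  filter_upwards [(tendsto_natCast_atTop_atTop (R := ℝ)).eventually_gt_atTop M] with n hn
  have hc : ContinuousAt (fun x' : ℝ => (n : ℝ) ^ 2 * x' + n) x := by fun_prop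
  have : M < (n : ℝ) ^ 2 * x + n := by nlinarith [mul_nonneg (sq_nonneg (n : ℝ)) hx]
  exact (hc.eventually (lt_mem_nhds this)).mono fun _ h => h.le

theorem tendsto_steep_atBot {x : ℝ} (hx : x < 0) :
    Tendsto (fun p : ℕ × ℝ => (p.1 : ℝ) ^ 2 * p.2 + p.1) (atTop.curry (𝓝 x)) atBot := by
  rw [tendsto_atBot]
  intro M
  have hlim : Tendsto (fun n : ℕ => (n : ℝ) ^ 2 * x + n) atTop atBot := by
    have h1 : Tendsto (fun n : ℕ => (n : ℝ) * x + 1) atTop atBot :=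
      tendsto_atBot_add_const_right _ _
        ((tendsto_natCast_atTop_atTop (R := ℝ)).atTop_mul_const_of_neg hx)
    refine ((tendsto_natCast_atTop_atTop (R := ℝ)).atTop_mul_atBot₀ h1).congr fun n => ?_
    ring
  rw [eventually_curry_iff]
  filter_upwards [hlim.eventually_lt_atBot M] with n hn
  have hc : ContinuousAt (fun x' : ℝ => (n : ℝ) ^ 2 * x' + n) x := by fun_prop
  exact (hc.eventually (gt_mem_nhds hn)).mono fun _ h => h.le

theorem tendsto_steep_comp {τ : ℝ → ℝ} {a b : ℝ} (ha : Tendsto τ atBot (𝓝 a))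
    (hb : Tendsto τ atTop (𝓝 b)) (hab : a ≠ b) (x : ℝ) :
    Tendsto (fun p : ℕ × ℝ => (b - a)⁻¹ * (τ ((p.1 : ℝ) ^ 2 * p.2 + p.1) - a))
      (atTop.curry (𝓝 x)) (𝓝 (heaviside x)) := by
  have hne : b - a ≠ 0 := sub_ne_zero.mpr hab.symm
  unfold heaviside
  split_ifs with hx
  · have := ((hb.comp (tendsto_steep_atTop hx)).sub_const a).const_mul (b - a)⁻¹
    rwa [inv_mul_cancel₀ hne] at this
  · have := ((ha.comp (tendsto_steep_atBot (not_le.mp hx))).sub_const a).const_mul (b - a)⁻¹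
    rwa [sub_self, mul_zero] at this

theorem IsSigmoidal.twoNeuronLimit_heaviside {σ : ℝ → ℝ} (h : IsSigmoidal σ) :
    TwoNeuronLimit σ heaviside := by
  obtain ⟨⟨a, b, ha, hb, hab⟩, -⟩ := h
  refine ⟨fun n => ![(n : ℝ) ^ 2, 0], fun n => ![(n : ℝ), 0], fun n => ![(b - a)⁻¹, 0],
    fun _ => -((b - a)⁻¹ * a), fun x => (tendsto_steep_comp ha hb hab x).congr fun p => ?_⟩
  simp [Fin.sum_univ_two]
  ring

theorem IsSigmoidal.twoNeuronLimit_id {σ : ℝ → ℝ} (h : IsSigmoidal σ) :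
    TwoNeuronLimit σ id := by
  obtain ⟨-, z, hd, -, hz⟩ := h
  refine ⟨fun n => ![((n : ℝ) + 1)⁻¹, 0], fun n => ![z, 0],
    fun n => ![(deriv σ z)⁻¹ * ((n : ℝ) + 1), 0],
    fun n => -((deriv σ z)⁻¹ * ((n : ℝ) + 1) * σ z), fun x => ?_⟩
  have hsmall : Tendsto (fun n : ℕ => ((n : ℝ) + 1)⁻¹ * x) atTop (𝓝 0) := by
    have h1 : Tendsto (fun n : ℕ => ((n : ℝ) + 1)⁻¹) atTop (𝓝 0) :=
      tendsto_inv_atTop_zero.comp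
        (tendsto_atTop_add_const_right _ _ (tendsto_natCast_atTop_atTop (R := ℝ)))
    simpa using h1.mul_const x
  have hshift : Tendsto (fun n : ℕ => ((n : ℝ) + 1)⁻¹ * x + z) atTop (𝓝 z) := by
    simpa using hsmall.add_const z
  refine tendsto_curry_of_continuousAt
    (f := fun n x' => ∑ s, (![(deriv σ z)⁻¹ * ((n : ℝ) + 1), 0] : Fin 2 → ℝ) s *
      σ ((![((n : ℝ) + 1)⁻¹, 0] : Fin 2 → ℝ) s * x' + (![z, 0] : Fin 2 → ℝ) s) +
      -((deriv σ z)⁻¹ * ((n : ℝ) + 1) * σ z)) ?_ ?_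
  -- The neuron is evaluated near `z` and not at `z`, which is why differentiability on a
  -- neighbourhood is used.
  · filter_upwards [hshift.eventually hd] with n hn
    have hc : ContinuousAt (fun x' => σ (((n : ℝ) + 1)⁻¹ * x' + z)) x :=
      ContinuousAt.comp (f := fun x' : ℝ => ((n : ℝ) + 1)⁻¹ * x' + z) hn.continuousAt (by fun_prop)
    simp only [Fin.sum_univ_two, Matrix.cons_val_zero, Matrix.cons_val_one, zero_mul, add_zero]
    exact (hc.const_mul _).add_const _
  · have hder := hd.self_of_nhds.hasDerivAt
    simp only [Fin.sum_univ_two, Matrix.cons_val_zero, Matrix.cons_val_one, zero_mul, add_zero]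
    rcases eq_or_ne x 0 with rfl | hx
    · simp
    have hs : Tendsto (fun n : ℕ => ((n : ℝ) + 1)⁻¹ * x) atTop (𝓝[≠] 0) := by
      refine tendsto_nhdsWithin_iff.mpr ⟨hsmall, Eventually.of_forall fun n => ?_⟩
      have : (n : ℝ) + 1 ≠ 0 := by positivity
      simp [this, hx]
    have := (((hasDerivAt_iff_tendsto_slope_zero.mp hder).comp hs).const_mul
      ((deriv σ z)⁻¹ * x))
    rw [mul_assoc, mul_comm x, ← mul_assoc, inv_mul_cancel₀ hz, one_mul] at this
    refine this.congr fun n => ?_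
    have hn : (n : ℝ) + 1 ≠ 0 := by positivity
    simp only [Function.comp, smul_eq_mul, mul_inv, inv_inv]
    rw [add_comm z]
    field_simp
    ring

theorem twoNeuronLimit_relu_heaviside : TwoNeuronLimit relu heaviside := by
  -- The difference of two ReLUs is a ramp from 0 to 1, which plays the role of a sigmoidal
  -- function; this is where the second neuron is needed.
  have ha : Tendsto (fun y => relu y - relu (y - 1)) atBot (𝓝 0) := by
    refine tendsto_const_nhds.congr' ?_
    filter_upwards [eventually_le_atBot (0 : ℝ)] with y hy
    simp [relu, hy, show y ≤ 1 by linarith]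
  have hb : Tendsto (fun y => relu y - relu (y - 1)) atTop (𝓝 1) := by
    refine tendsto_const_nhds.congr' ?_
    filter_upwards [eventually_ge_atTop (1 : ℝ)] with y hy
    simp [relu, hy, show 0 ≤ y by linarith]
  refine ⟨fun n => ![(n : ℝ) ^ 2, (n : ℝ) ^ 2], fun n => ![(n : ℝ), n - 1], fun n => ![1, -1],
    fun _ => 0, fun x => (tendsto_steep_comp ha hb zero_ne_one x).congr fun p => ?_⟩
  simp [Fin.sum_univ_two, sub_eq_add_neg, add_assoc]

theorem twoNeuronLimit_relu_id : TwoNeuronLimit relu id := by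
  refine ⟨fun n => ![1, 0], fun n => ![(n : ℝ), 0], fun n => ![1, 0], fun n => -(n : ℝ),
    fun x => ?_⟩
  have : Tendsto (fun p : ℕ × ℝ => relu (p.2 + p.1) - p.1) (atTop.curry (𝓝 x)) (𝓝 x) := by
    refine tendsto_curry_of_continuousAt (f := fun n x' => relu (x' + n) - n) ?_ ?_
    · unfold relu
      exact Eventually.of_forall fun n => by fun_prop
    · refine tendsto_const_nhds.congr' ?_
      filter_upwards [(tendsto_natCast_atTop_atTop (R := ℝ)).eventually_ge_atTop (-x)] with n hn
      simp [relu, show 0 ≤ x + n by linarith]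
  refine this.congr fun p => ?_
  simp [Fin.sum_univ_two]
  ring

/-! ### From limit units to actual parameters -/

/-- Some parameters of the network fit the values `y` within any prescribed error, not only at the
points `S i` but also in a neighbourhood of each of them. -/
def RobustFit {ι : Type} (σ : ℝ → ℝ) (n : ℕ) (ds : List ℕ) (S : ι → Fin n → ℝ) (y : ι → ℝ) : Prop :=
  ∀ ε : ℝ, 0 < ε → ∃ θ : NetParams n ds, ∀ i, ∀ᶠ x in 𝓝 (S i), |netEval σ n ds θ x - y i| ≤ ε

theorem exists_netEval_affine (σ : ℝ → ℝ) {n m : ℕ} (ds : List ℕ) (θ : NetParams m ds)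
    (A : Matrix (Fin m) (Fin n) ℝ) (b : Fin m → ℝ) :
    ∃ θ' : NetParams n ds, ∀ x, netEval σ n ds θ' x = netEval σ m ds θ (A.mulVec x + b) := by
  cases ds with
  | nil =>
    refine ⟨(Matrix.vecMul θ.1 A, θ.1 ⬝ᵥ b + θ.2), fun x => ?_⟩
    change Matrix.vecMul θ.1 A ⬝ᵥ x + (θ.1 ⬝ᵥ b + θ.2) = θ.1 ⬝ᵥ (A.mulVec x + b) + θ.2
    rw [← Matrix.dotProduct_mulVec, dotProduct_add, add_assoc]
  | cons d ds =>
    refine ⟨((θ.1.1 * A, θ.1.1.mulVec b + θ.1.2), θ.2), fun x => ?_⟩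
    simp only [netEval]
    congr 1
    funext i
    rw [← Matrix.mulVec_mulVec, Matrix.mulVec_add]
    simp [add_assoc]

/-- The parameters of the tail are fixed first, and they fit on neighbourhoods of the ideal hidden
states. Late approximants of the units map a neighbourhood of each `S i` into these, so robustness
passes one layer down even though step units are discontinuous. -/
theorem RobustFit.layer {ι κ : Type} [Finite ι] [Fintype κ] {σ : ℝ → ℝ} {n m d : ℕ} {ds : List ℕ}
    (hd : Fintype.card κ * 2 = d) {g : κ → ℝ → ℝ} (hg : ∀ k, TwoNeuronLimit σ (g k))
    (W : κ → Fin n → ℝ) (b : κ → ℝ) (V : Fin m → κ → ℝ) (c : Fin m → ℝ) {S : ι → Fin n → ℝ}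
    {y : ι → ℝ}
    (h : RobustFit σ m ds (fun i j => ∑ k, V j k * g k (W k ⬝ᵥ S i + b k) + c j) y) :
    RobustFit σ n (d :: ds) S y := by
  choose α β γ γ₀ hlim using hg
  intro ε hε
  obtain ⟨θ, hθ⟩ := h ε hε
  have key : ∀ i, Tendsto (fun p : ℕ × (Fin n → ℝ) => fun j => ∑ k, V j k *
      (∑ s, γ k p.1 s * σ (α k p.1 s * (W k ⬝ᵥ p.2 + b k) + β k p.1 s) + γ₀ k p.1) + c j)
      (atTop.curry (𝓝 (S i))) (𝓝 (fun j => ∑ k, V j k * g k (W k ⬝ᵥ S i + b k) + c j)) := by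
    intro i
    refine tendsto_pi_nhds.mpr fun j => (tendsto_finsetSum _ fun k _ => ?_).add_const _
    refine Tendsto.const_mul _ ?_
    have hcomp : Tendsto (fun p : ℕ × (Fin n → ℝ) => (p.1, W k ⬝ᵥ p.2 + b k))
        (atTop.curry (𝓝 (S i))) (atTop.curry (𝓝 (W k ⬝ᵥ S i + b k))) := by
      intro U hU
      rw [mem_curry_iff] at hU
      refine (eventually_curry_iff.mpr ?_ : ∀ᶠ p in _, _)
      filter_upwards [hU] with q hq
      have hc : ContinuousAt (fun x : Fin n → ℝ => W k ⬝ᵥ x + b k) (S i) := by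
        exact ((continuous_const.dotProduct continuous_id).add continuous_const).continuousAt
      exact hc.eventually hq
    exact (hlim k _).comp hcomp
  -- There are finitely many points, so one index `q` serves them all.
  obtain ⟨q, hq⟩ := (eventually_all.mpr fun i =>
    eventually_curry_iff.mp ((key i).eventually (hθ i))).exists
  let e : κ × Fin 2 ≃ Fin d := Fintype.equivFinOfCardEq (by simp [hd])
  -- The outer coefficients of the two-neuron combinations are affine and merge into the first
  -- affine map of the tail.
  obtain ⟨θ', hθ'⟩ := exists_netEval_affine (n := d) σ ds θ
    (Matrix.of fun j l => V j (e.symm l).1 * γ (e.symm l).1 q (e.symm l).2)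
    (fun j => ∑ k, V j k * γ₀ k q + c j)
  refine ⟨((Matrix.of fun l r => α (e.symm l).1 q (e.symm l).2 * W (e.symm l).1 r,
    fun l => α (e.symm l).1 q (e.symm l).2 * b (e.symm l).1 + β (e.symm l).1 q (e.symm l).2), θ'),
    fun i => (hq i).mono fun x hx => ?_⟩
  simp only [netEval, hθ']
  convert hx using 4
  funext j
  simp only [Pi.add_apply, Matrix.mulVec, dotProduct, Matrix.of_apply]
  rw [← add_assoc, ← e.sum_comp]
  congr 1
  simp only [Equiv.symm_apply_apply, Fintype.sum_prod_type, mul_add, Finset.sum_add_distrib]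
  congr 1
  refine Finset.sum_congr rfl fun k _ => ?_
  rw [Finset.mul_sum]
  refine Finset.sum_congr rfl fun s _ => ?_
  rw [mul_assoc]
  congr 3
  simp only [Finset.mul_sum, mul_assoc, add_assoc]

theorem RobustFit.id_layer {ι : Type} [Finite ι] {σ : ℝ → ℝ} (hid : TwoNeuronLimit σ id) {n m : ℕ}
    {ds : List ℕ} (A : Matrix (Fin m) (Fin n) ℝ) (b : Fin m → ℝ) {S : ι → Fin n → ℝ} {y : ι → ℝ}
    (h : RobustFit σ m ds (fun i => A.mulVec (S i) + b) y) :
    RobustFit σ n (m * 2 :: ds) S y := by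
  refine RobustFit.layer (κ := Fin m) (m := m) (by simp) (fun _ => hid) A b
    (1 : Matrix (Fin m) (Fin m) ℝ) 0 ?_
  convert h using 3 with i j
  simp [Matrix.one_apply, Matrix.mulVec]

/-! ### Networks of step layers -/

/-- `T` is computed from the states `S` by one layer with `e` step units and a skip connection:
`T i = A (S i) + c + ∑ₖ 1[Wₖ ⬝ S i ≥ tₖ] Vₖ`. -/
def StepLayer {ι : Type} (e : ℕ) (S T : ι → Fin 3 → ℝ) : Prop :=
  ∃ (κ : Type) (_ : Fintype κ) (A : Matrix (Fin 3) (Fin 3) ℝ) (c : Fin 3 → ℝ)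
    (W V : κ → Fin 3 → ℝ) (t : κ → ℝ), Fintype.card κ = e ∧
    ∀ i j, T i j = A.mulVec (S i) j + c j + ∑ k, V k j * heaviside (W k ⬝ᵥ S i - t k)

theorem RobustFit.stepLayer {ι : Type} [Finite ι] {σ : ℝ → ℝ} (hid : TwoNeuronLimit σ id)
    (hstep : TwoNeuronLimit σ heaviside) {e : ℕ} {ds : List ℕ} {S T : ι → Fin 3 → ℝ} {y : ι → ℝ}
    (hST : StepLayer e S T) (h : RobustFit σ 3 ds T y) :
    RobustFit σ 3 ((e + 3) * 2 :: 6 :: ds) S y := by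
  obtain ⟨κ, _, A, c, W, V, t, hκ, hT⟩ := hST
  refine RobustFit.layer (κ := κ ⊕ Fin 3) (m := 3)
    (g := Sum.elim (fun _ => heaviside) (fun _ => id)) (by simp [hκ])
    (by rintro (k | k) <;> simpa) (Sum.elim W (1 : Matrix (Fin 3) (Fin 3) ℝ))
    (Sum.elim (fun k => - t k) 0) (fun j => Sum.elim (fun k => V k j) (A j)) c ?_
  refine RobustFit.id_layer (m := 3) hid 1 0 ?_
  convert h using 2 with i
  funext j
  have hone : ∀ k : Fin 3, ((1 : Matrix (Fin 3) (Fin 3) ℝ) k) ⬝ᵥ S i = S i k := fun k =>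
    congrFun (Matrix.one_mulVec (S i)) k
  rw [Matrix.one_mulVec, add_zero, Fintype.sum_sum_type, hT]
  change ∑ k, V k j * heaviside (W k ⬝ᵥ S i + -t k) +
    ∑ k, A j k * ((1 : Matrix (Fin 3) (Fin 3) ℝ) k ⬝ᵥ S i + 0) + c j = _
  simp only [hone, add_zero, ← sub_eq_add_neg]
  change _ = ∑ k, A j k * S i k + _ + _
  ring

/-- The network consisting of step layers with `es` step units can turn the states `S` into states
with first coordinate `y`. -/
inductive StepChain {ι : Type} : List ℕ → (ι → Fin 3 → ℝ) → (ι → ℝ) → Prop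
  | nil (S : ι → Fin 3 → ℝ) (y : ι → ℝ) (h : ∀ i, S i 0 = y i) : StepChain [] S y
  | cons {e : ℕ} {es : List ℕ} {S T : ι → Fin 3 → ℝ} {y : ι → ℝ} (hST : StepLayer e S T)
      (h : StepChain es T y) : StepChain (e :: es) S y

theorem StepChain.robustFit {ι : Type} [Finite ι] {σ : ℝ → ℝ} (hid : TwoNeuronLimit σ id)
    (hstep : TwoNeuronLimit σ heaviside) {es : List ℕ} {S : ι → Fin 3 → ℝ} {y : ι → ℝ}
    (h : StepChain es S y) : RobustFit σ 3 (es.flatMap fun e => [(e + 3) * 2, 6]) S y := by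
  induction h with
  | nil S y h =>
    intro ε hε
    refine ⟨((Pi.single 0 1 : Fin 3 → ℝ), (0 : ℝ)), fun i => ?_⟩
    have hc : ContinuousAt (fun x : Fin 3 → ℝ => |x 0 - y i|) (S i) :=
      (((continuous_apply 0).sub continuous_const).abs).continuousAt
    have : |S i 0 - y i| < ε := by simpa [h i] using hε
    refine (hc.eventually (gt_mem_nhds this)).mono fun x hx => ?_
    change |∑ j, (Pi.single 0 1 : Fin 3 → ℝ) j * x j + 0 - y i| ≤ ε
    simpa [Fin.sum_univ_three] using hx.le
  | cons hST h ih => exact RobustFit.stepLayer hid hstep hST ih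

theorem numParams_flatMap (es : List ℕ) :
    numParams 6 (es.flatMap fun e => [(e + 3) * 2, 6]) = 26 * es.sum + 84 * es.length + 7 := by
  induction es with
  | nil => rfl
  | cons e es ih =>
    simp only [List.flatMap_cons, List.cons_append, List.nil_append, numParams, ih, List.sum_cons,
      List.length_cons]
    ring

theorem TwoNeuronLimit.of_activation {σ : ℝ → ℝ} (h : IsSigmoidal σ ∨ σ = relu) :
    TwoNeuronLimit σ id ∧ TwoNeuronLimit σ heaviside := by
  rcases h with h | rfl
  · exact ⟨h.twoNeuronLimit_id, h.twoNeuronLimit_heaviside⟩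
  · exact ⟨twoNeuronLimit_relu_id, twoNeuronLimit_relu_heaviside⟩

/-- The hidden layer dimensions of the network that projects its input to a line and then runs step
layers with `es` step units. -/
def chainArchitecture (es : List ℕ) : List ℕ := 6 :: es.flatMap fun e => [(e + 3) * 2, 6]

theorem canMemorize_chainArchitecture {σ : ℝ → ℝ} (hσ : IsSigmoidal σ ∨ σ = relu) {dx C : ℕ}
    {X : Finset (EuclideanSpace ℝ (Fin dx))} {y : X → Fin C} {es : List ℕ} (v : Fin dx → ℝ) (b : ℝ)
    (h : StepChain es (fun x : X => ![v ⬝ᵥ (x : EuclideanSpace ℝ (Fin dx)) + b, 0, 0])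
      (fun x => ((y x : ℕ) : ℝ))) : CanMemorize σ dx (chainArchitecture es) X y := by
  obtain ⟨hid, hstep⟩ := TwoNeuronLimit.of_activation hσ
  have hfit := h.robustFit hid hstep
  intro ε hε
  obtain ⟨θ, hθ⟩ := RobustFit.id_layer (m := 3) hid (Matrix.of ![v, 0, 0]) ![b, 0, 0]
    (S := fun (x : X) j => (x : EuclideanSpace ℝ (Fin dx)) j) (by
      convert hfit using 2 with x
      funext j
      fin_cases j <;> simp) ε hε
  exact ⟨θ, fun x => (hθ x).self_of_nhds⟩

theorem one_le_of_mem_chainArchitecture {es : List ℕ} {d : ℕ} (h : d ∈ chainArchitecture es) :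
    1 ≤ d := by
  simp only [chainArchitecture, List.mem_cons, List.mem_flatMap, List.not_mem_nil, or_false] at h
  omega

theorem length_chainArchitecture (es : List ℕ) :
    (chainArchitecture es).length = 1 + 2 * es.length := by
  simp [chainArchitecture, List.length_flatMap, mul_comm]
  omega

theorem numParams_chainArchitecture (dx : ℕ) (es : List ℕ) :
    numParams dx (chainArchitecture es) = 6 * dx + 13 + 26 * es.sum + 84 * es.length := by
  simp only [chainArchitecture, numParams, numParams_flatMap]
  ring

/-! ### Shortening the interval by piecewise translations -/

/-- Points on the line with pairwise distances at least one. -/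
def OneSeparated {ι : Type} (z : ι → ℝ) : Prop := ∀ i j, i ≠ j → 1 ≤ |z i - z j|

theorem card_filter_abs_add_natCast_lt_one_le (a : ℝ) (S : ℕ) :
    ((Finset.range S).filter fun s : ℕ => |a + s| < 1).card ≤ 2 := by
  have h : ((Finset.range S).filter fun s : ℕ => |a + s| < 1).card ≤
      ({⌊-a⌋, ⌊-a⌋ + 1} : Finset ℤ).card := by
    refine Finset.card_le_card_of_injOn (fun s => (s : ℤ)) (fun s hs => ?_)
      (fun s _ t _ h => by simpa using h)
    have hs' : |a + s| < 1 := (Finset.mem_filter.mp hs).2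
    obtain ⟨h1, h2⟩ := abs_lt.mp hs'
    have h3 : ⌊-a⌋ ≤ (s : ℤ) := by
      have := Int.floor_le (-a)
      have h4 : (⌊-a⌋ : ℝ) < ((s : ℤ) : ℝ) + 1 := by push_cast; linarith
      exact Int.lt_add_one_iff.mp (by exact_mod_cast h4)
    have h5 : (s : ℤ) ≤ ⌊-a⌋ + 1 := by
      have := Int.lt_floor_add_one (-a)
      have h6 : ((s : ℤ) : ℝ) < (⌊-a⌋ + 1 : ℝ) + 1 := by push_cast; linarith
      exact Int.lt_add_one_iff.mp (by exact_mod_cast h6)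
    simp only [Finset.coe_insert, Finset.coe_singleton, Set.mem_insert_iff, Set.mem_singleton_iff]
    omega
  exact h.trans (Finset.card_le_two)

/-- Greedy choice, one class at a time. A pair of a point in the new class and any other point
excludes at most two integer shifts, because an open interval of length 2 contains at most two
integers; that makes at most `2 n |ι| < S` excluded shifts. Inside a class the differences do not
change. -/
theorem exists_class_shift {ι : Type} [Fintype ι] {z : ι → ℝ} (hz : OneSeparated z) (β : ι → ℕ)
    (base : ℕ → ℝ) {n S : ℕ} (hn : ∀ b, (Finset.univ.filter fun i => β i = b).card ≤ n)
    (hS : 2 * n * Fintype.card ι < S) (J : ℕ) :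
    ∃ s : ℕ → ℕ, (∀ b, s b < S) ∧ ∀ i j, i ≠ j → β i < J → β j < J →
      1 ≤ |(z i + s (β i) - base (β i)) - (z j + s (β j) - base (β j))| := by
  classical
  induction J with
  | zero => exact ⟨fun _ => 0, fun _ => Nat.zero_lt_of_lt hS, fun i j _ h => absurd h (Nat.not_lt_zero _)⟩
  | succ J ih =>
    obtain ⟨s, hs, hsep⟩ := ih
    let bad : Finset ℕ := ((Finset.univ.filter fun i => β i = J) ×ˢ Finset.univ).biUnion
      fun p => (Finset.range S).filter fun t : ℕ =>
        |(z p.1 - base J - (z p.2 + s (β p.2) - base (β p.2))) + t| < 1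
    have hbad : bad.card < S := by
      refine lt_of_le_of_lt (Finset.card_biUnion_le_card_mul _ _ 2 fun p _ =>
        card_filter_abs_add_natCast_lt_one_le _ _) ?_
      rw [Finset.card_product, Finset.card_univ]
      refine lt_of_le_of_lt ?_ hS
      rw [mul_comm, mul_assoc]
      exact Nat.mul_le_mul_left 2 (Nat.mul_le_mul_right _ (hn J))
    obtain ⟨t, ht, htbad⟩ : ∃ t ∈ Finset.range S, t ∉ bad :=
      Finset.exists_mem_notMem_of_card_lt_card (by simpa using hbad)
    have hgood : ∀ i j, β i = J →
        1 ≤ |(z i + t - base J) - (z j + s (β j) - base (β j))| := by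
      intro i j hi
      by_contra hlt
      refine htbad (Finset.mem_biUnion.mpr ⟨(i, j), by simp [hi], Finset.mem_filter.mpr ⟨ht, ?_⟩⟩)
      rw [show z i - base J - (z j + s (β j) - base (β j)) + (t : ℝ) =
        z i + t - base J - (z j + s (β j) - base (β j)) by ring]
      exact not_le.mp hlt
    refine ⟨Function.update s J t, fun b => ?_, fun i j hij hi hj => ?_⟩
    · rcases eq_or_ne b J with rfl | hb
      · simpa using ht
      · simpa [hb] using hs b
    · rcases eq_or_ne (β i) J with hi' | hi' <;> rcases eq_or_ne (β j) J with hj' | hj'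
      · rw [hi', hj']
        convert hz i j hij using 2
        ring
      · rw [Function.update_of_ne hj', hi', Function.update_self]
        exact hgood i j hi'
      · rw [Function.update_of_ne hi', hj', Function.update_self, abs_sub_comm]
        exact hgood j i hj'
      · rw [Function.update_of_ne hi', Function.update_of_ne hj']
        exact hsep i j hij (by omega) (by omega)

theorem exists_thresholds {ι : Type} [Finite ι] {z : ι → ℝ} {β : ι → ℕ}
    (hβ : ∀ i j, z i ≤ z j → β i ≤ β j) : ∃ t : ℕ → ℝ, ∀ k i, t k ≤ z i ↔ k < β i := by
  have : ∀ k, ∃ t : ℝ, ∀ i, t ≤ z i ↔ k < β i := by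
    intro k
    by_cases h : ∃ i, k < β i
    · obtain ⟨i, hi, hmin⟩ := Set.exists_min_image {i | k < β i} z (Set.toFinite _) h
      exact ⟨z i, fun j => ⟨fun hj => lt_of_lt_of_le hi (hβ i j hj), fun hj => hmin j hj⟩⟩
    · obtain ⟨M, hM⟩ := (Set.finite_range z).bddAbove
      refine ⟨M + 1, fun i => ⟨fun hi => ?_, fun hi => absurd ⟨i, hi⟩ h⟩⟩
      have := hM (Set.mem_range_self i)
      linarith
  choose t ht using this
  exact ⟨t, ht⟩

/-- The increments of `G` telescope up to `β i`. Hence any function of a monotone index with values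
in `0, …, J` costs `J` step units. -/
theorem sum_heaviside_table {ι : Type} {z : ι → ℝ} {β : ι → ℕ} {t : ℕ → ℝ}
    (ht : ∀ k i, t k ≤ z i ↔ k < β i) {J : ℕ} (hJ : ∀ i, β i ≤ J) (G : ℕ → ℝ) (i : ι) :
    ∑ k : Fin J, (G (k + 1) - G k) * heaviside (z i - t k) = G (β i) - G 0 := by
  rw [Fin.sum_univ_eq_sum_range (fun k => (G (k + 1) - G k) * heaviside (z i - t k)) J,
    ← Finset.sum_range_sub]
  have hle := hJ i
  rw [← Finset.sum_subset (Finset.range_mono hle)]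
  · refine Finset.sum_congr rfl fun k hk => ?_
    simp [heaviside, (ht k i).mpr (Finset.mem_range.mp hk)]
  · intro k _ hk
    have : ¬ t k ≤ z i := fun h => hk (Finset.mem_range.mpr ((ht k i).mp h))
    simp [heaviside, this]

theorem StepLayer.of_tables {ι : Type} [Finite ι] {S T : ι → Fin 3 → ℝ}
    (A : Matrix (Fin 3) (Fin 3) ℝ) (W₁ W₂ : Fin 3 → ℝ) {β₁ β₂ : ι → ℕ} {J₁ J₂ : ℕ}
    (h₁ : ∀ i j, W₁ ⬝ᵥ S i ≤ W₁ ⬝ᵥ S j → β₁ i ≤ β₁ j)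
    (h₂ : ∀ i j, W₂ ⬝ᵥ S i ≤ W₂ ⬝ᵥ S j → β₂ i ≤ β₂ j)
    (hJ₁ : ∀ i, β₁ i ≤ J₁) (hJ₂ : ∀ i, β₂ i ≤ J₂) (G₁ G₂ : ℕ → Fin 3 → ℝ)
    (hT : ∀ i j, T i j = A.mulVec (S i) j + G₁ (β₁ i) j + G₂ (β₂ i) j) :
    StepLayer (J₁ + J₂) S T := by
  obtain ⟨t₁, ht₁⟩ := exists_thresholds h₁
  obtain ⟨t₂, ht₂⟩ := exists_thresholds h₂
  refine ⟨Fin J₁ ⊕ Fin J₂, inferInstance, A, G₁ 0 + G₂ 0, Sum.elim (fun _ => W₁) (fun _ => W₂),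
    Sum.elim (fun k j => G₁ (k + 1) j - G₁ k j) (fun k j => G₂ (k + 1) j - G₂ k j),
    Sum.elim (fun k => t₁ k) (fun k => t₂ k), by simp, fun i j => ?_⟩
  have e₁ := sum_heaviside_table ht₁ hJ₁ (fun k => G₁ k j) i
  have e₂ := sum_heaviside_table ht₂ hJ₂ (fun k => G₂ k j) i
  simp only [Fintype.sum_sum_type, Sum.elim_inl, Sum.elim_inr, e₁, e₂, hT, Pi.add_apply]
  ring

theorem StepLayer.of_table {ι : Type} [Finite ι] {S T : ι → Fin 3 → ℝ}
    (A : Matrix (Fin 3) (Fin 3) ℝ) (W : Fin 3 → ℝ) {β : ι → ℕ} {J : ℕ}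
    (h : ∀ i j, W ⬝ᵥ S i ≤ W ⬝ᵥ S j → β i ≤ β j) (hJ : ∀ i, β i ≤ J) (G : ℕ → Fin 3 → ℝ)
    (hT : ∀ i j, T i j = A.mulVec (S i) j + G (β i) j) : StepLayer J S T :=
  StepLayer.of_tables A W 0 (β₂ := fun _ => 0) (J₂ := 0) h (fun _ _ _ => le_rfl) hJ
    (fun _ => le_rfl) G 0 (fun i j => by simp [hT])

theorem exists_eq_comp_of_factors {ι α : Type} [Nonempty α] (β : ι → ℕ) (F : ι → α)
    (h : ∀ i j, β i = β j → F i = F j) : ∃ G : ℕ → α, ∀ i, G (β i) = F i :=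
  ⟨Function.extend β F fun _ => Classical.arbitrary α, fun i =>
    Function.FactorsThrough.extend_apply (fun _ _ hij => h _ _ hij) _ i⟩

/-- Two partitions are intersected: intervals of length `ℓ`, and runs of `n` consecutive points.
Each class then fits in an interval of length `ℓ` and has at most `n` points, so it can be moved to
the origin and shifted by less than `S`. -/
theorem exists_hash_layer {ι : Type} [Fintype ι] {z : ι → ℝ} (hz : OneSeparated z)
    (hz₀ : ∀ i, 0 ≤ z i) {ℓ : ℝ} (hℓ : 0 < ℓ) {J₁ J₂ n S : ℕ} (hJ₁ : ∀ i, z i < ℓ * (J₁ + 1))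
    (hn : 0 < n) (hJ₂ : Fintype.card ι ≤ n * (J₂ + 1)) (hS : 2 * n * Fintype.card ι < S) :
    ∃ z' : ι → ℝ, OneSeparated z' ∧ (∀ i, 0 ≤ z' i) ∧ (∀ i, z' i < ℓ + S) ∧
      StepLayer (J₁ + J₂) (fun i => ![z i, 0, 0]) (fun i => ![z' i, 0, 0]) := by
  classical
  let rank : ι → ℕ := fun i => (Finset.univ.filter fun j => z j < z i).card
  have hrank_mono : ∀ i j, z i ≤ z j → rank i ≤ rank j := fun i j hij =>
    Finset.card_le_card fun k hk => by
      simp only [Finset.mem_filter, Finset.mem_univ, true_and] at hk ⊢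
      exact hk.trans_le hij
  have hz_inj : Function.Injective z := fun i j hij => by
    by_contra hne
    have := hz i j hne
    rw [hij] at this
    norm_num at this
  have hrank_strict : ∀ i j, z i < z j → rank i < rank j := fun i j hij =>
    Finset.card_lt_card ⟨fun k hk => by
      simp only [Finset.mem_filter, Finset.mem_univ, true_and] at hk ⊢
      exact hk.trans hij, fun hsub => by
      have := hsub (x := i) (by simpa using hij)
      simp at this⟩
  have hrank_inj : Function.Injective rank := fun i j hij => by
    rcases lt_trichotomy (z i) (z j) with h | h | h
    · exact absurd hij (hrank_strict i j h).ne
    · exact hz_inj h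
    · exact absurd hij (hrank_strict j i h).ne'
  have hrank_lt : ∀ i, rank i < Fintype.card ι := fun i => by
    rw [← Finset.card_univ]
    exact Finset.card_lt_card ⟨Finset.subset_univ _, fun hsub => by
      have := hsub (Finset.mem_univ i)
      simp at this⟩
  -- Both summands are monotone in `z`, so equal sums force equal summands. The sum therefore
  -- indexes the common refinement with only `J₁ + J₂` thresholds.
  let β : ι → ℕ := fun i => ⌊z i / ℓ⌋₊ + rank i / n
  have hfl_mono : ∀ i j, z i ≤ z j → ⌊z i / ℓ⌋₊ ≤ ⌊z j / ℓ⌋₊ := fun i j hij =>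
    Nat.floor_mono (div_le_div_of_nonneg_right hij hℓ.le)
  have hβ_mono : ∀ i j, z i ≤ z j → β i ≤ β j := fun i j hij =>
    add_le_add (hfl_mono i j hij) (Nat.div_le_div_right (hrank_mono i j hij))
  have hclass : ∀ i j, β i = β j → ⌊z i / ℓ⌋₊ = ⌊z j / ℓ⌋₊ ∧ rank i / n = rank j / n := by
    intro i j hij
    have hij' : ⌊z i / ℓ⌋₊ + rank i / n = ⌊z j / ℓ⌋₊ + rank j / n := hij
    rcases le_total (z i) (z j) with h | h
    · have h1 := hfl_mono i j h
      have h2 : rank i / n ≤ rank j / n := Nat.div_le_div_right (hrank_mono i j h)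
      omega
    · have h1 := hfl_mono j i h
      have h2 : rank j / n ≤ rank i / n := Nat.div_le_div_right (hrank_mono j i h)
      omega
  have hcard : ∀ b, (Finset.univ.filter fun i => β i = b).card ≤ n := by
    intro b
    rcases (Finset.univ.filter fun i => β i = b).eq_empty_or_nonempty with h | ⟨i₀, hi₀⟩
    · simp [h]
    · have hi₀' : β i₀ = b := (Finset.mem_filter.mp hi₀).2
      calc _ ≤ (Finset.Ico (rank i₀ / n * n) (rank i₀ / n * n + n)).card := by
            refine Finset.card_le_card_of_injOn rank (fun i hi => ?_) hrank_inj.injOn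
            have hi' : β i = b := (Finset.mem_filter.mp hi).2
            have h := (hclass i i₀ (hi'.trans hi₀'.symm)).2
            rw [← h, Finset.coe_Ico]
            exact ⟨Nat.div_mul_le_self _ _, Nat.lt_div_mul_add hn⟩
        _ = n := by simp
  obtain ⟨base, hbase⟩ := exists_eq_comp_of_factors β (fun i => ℓ * (⌊z i / ℓ⌋₊ : ℝ))
    (fun i j hij => by rw [(hclass i j hij).1])
  have hβ_le : ∀ i, β i ≤ J₁ + J₂ := by
    intro i
    have h1 : ⌊z i / ℓ⌋₊ < J₁ + 1 := by
      rw [Nat.floor_lt (div_nonneg (hz₀ i) hℓ.le), div_lt_iff₀ hℓ]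
      push_cast
      linarith [hJ₁ i]
    have h2 : rank i / n < J₂ + 1 :=
      Nat.div_lt_of_lt_mul ((hrank_lt i).trans_le hJ₂)
    change ⌊z i / ℓ⌋₊ + rank i / n ≤ _
    omega
  obtain ⟨s, hsS, hsep⟩ := exists_class_shift hz β base hcard hS (J₁ + J₂ + 1)
  refine ⟨fun i => z i + s (β i) - base (β i), fun i j hij => hsep i j hij
    (Nat.lt_succ_of_le (hβ_le i)) (Nat.lt_succ_of_le (hβ_le j)), fun i => ?_, fun i => ?_, ?_⟩
  · have h := Nat.floor_le (div_nonneg (hz₀ i) hℓ.le)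
    rw [le_div_iff₀ hℓ] at h
    simp only [hbase]
    have : (0 : ℝ) ≤ s (β i) := Nat.cast_nonneg _
    linarith
  · have h := Nat.lt_floor_add_one (z i / ℓ)
    rw [div_lt_iff₀ hℓ] at h
    simp only [hbase]
    have : (s (β i) : ℝ) ≤ S := by exact_mod_cast (hsS _).le
    linarith
  · refine StepLayer.of_table 1 ![1, 0, 0] (β := β) (fun i j hij => hβ_mono i j ?_) hβ_le
      (fun b => ![(s b : ℝ) - base b, 0, 0]) (fun i j => ?_)
    · simpa [dotProduct, Fin.sum_univ_three] using hij
    · rw [Matrix.one_mulVec]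
      fin_cases j <;> simp
      ring

/-- The term `6 N²` absorbs the shifts, where `N` is the number of points: half of it plus `S = 2 N²
+ 1` is at most `6 N²`, so only `K` is halved. -/
theorem StepChain.halving {ι : Type} [Fintype ι] [Nonempty ι] {es : List ℕ} {y : ι → ℝ} (L : ℕ)
    {K : ℝ} (hK : 0 ≤ K)
    (h : ∀ z : ι → ℝ, OneSeparated z → (∀ i, 0 ≤ z i) →
      (∀ i, z i < K / 2 ^ L + 6 * (Fintype.card ι : ℝ) ^ 2) →
      StepChain es (fun i => ![z i, 0, 0]) y)
    {z : ι → ℝ} (hz : OneSeparated z) (hz₀ : ∀ i, 0 ≤ z i)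
    (hzK : ∀ i, z i < K + 6 * (Fintype.card ι : ℝ) ^ 2) :
    StepChain (List.replicate L 1 ++ es) (fun i => ![z i, 0, 0]) y := by
  have hN : (1 : ℝ) ≤ Fintype.card ι := by exact_mod_cast Fintype.card_pos
  induction L generalizing K z with
  | zero => exact h z hz hz₀ (by simpa using hzK)
  | succ L ih =>
    obtain ⟨z', hz', hz₀', hzK', hlayer⟩ := exists_hash_layer hz hz₀
      (ℓ := (K + 6 * (Fintype.card ι : ℝ) ^ 2) / 2) (by positivity) (J₁ := 1) (J₂ := 0)
      (n := Fintype.card ι) (S := 2 * Fintype.card ι * Fintype.card ι + 1)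
      (fun i => (hzK i).trans_eq (by push_cast; ring)) Fintype.card_pos (by simp) (by omega)
    refine StepChain.cons hlayer (ih (K := K / 2) (by positivity) ?_ hz' hz₀' fun i => ?_)
    · intro z hz hz₀ hzK
      refine h z hz hz₀ fun i => (hzK i).trans_eq ?_
      rw [div_div, ← pow_succ']
    · refine (hzK' i).trans_le ?_
      push_cast
      nlinarith

/-! ### Projection to a line -/

/-- Once the other coordinates are fixed, at most one value of coordinate `k` lands in the slab,
since a unit change there moves the sum by at least the slab's width `2s`. Overwriting that
coordinate is thus injective on slab points paired with new values. -/
theorem card_slab_mul_le {d M : ℕ} (u : Fin d → ℝ) {s : ℝ} (k : Fin d) (hk : 2 * s ≤ |u k|) :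
    (Finset.univ.filter fun f : Fin d → Fin M => |∑ l, ((f l : ℕ) : ℝ) * u l| < s).card * M ≤
      M ^ d := by
  classical
  have hle : ((Finset.univ.filter fun f : Fin d → Fin M => |∑ l, ((f l : ℕ) : ℝ) * u l| < s) ×ˢ
      (Finset.univ : Finset (Fin M))).card ≤ (Finset.univ : Finset (Fin d → Fin M)).card := by
    refine Finset.card_le_card_of_injOn (fun p => Function.update p.1 k p.2)
      (fun _ _ => Finset.mem_coe.mpr (Finset.mem_univ _)) ?_
    rintro ⟨f, a⟩ hf ⟨f', a'⟩ hf' heq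
    simp only [Finset.coe_product, Set.mem_prod, Finset.mem_coe, Finset.mem_filter,
      Finset.mem_univ, true_and, and_true] at hf hf'
    have ha : a = a' := by simpa using congrFun heq k
    have hoff : ∀ l, l ≠ k → f l = f' l := fun l hl => by simpa [hl] using congrFun heq l
    have hdiff : ∑ l, ((f l : ℕ) : ℝ) * u l - ∑ l, ((f' l : ℕ) : ℝ) * u l =
        (((f k : ℕ) : ℝ) - ((f' k : ℕ) : ℝ)) * u k := by
      rw [← Finset.sum_sub_distrib, Finset.sum_eq_single k]
      · ring
      · intro l _ hl
        rw [hoff l hl, sub_self]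
      · simp
    have hlt : |((f k : ℕ) : ℝ) - ((f' k : ℕ) : ℝ)| * |u k| < |u k| := by
      rw [← abs_mul, ← hdiff]
      refine lt_of_lt_of_le (lt_of_le_of_lt (abs_sub _ _) (add_lt_add hf hf')) ?_
      linarith
    have hfk : f k = f' k := by
      have hpos : 0 < |u k| := lt_of_le_of_lt (by positivity) hlt
      have h1 : |((f k : ℕ) : ℝ) - ((f' k : ℕ) : ℝ)| < 1 := by
        by_contra hcon
        nlinarith
      have h2 : |((f k : ℕ) : ℤ) - ((f' k : ℕ) : ℤ)| < 1 := by exact_mod_cast h1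
      have h3 := Int.abs_lt_one_iff.mp h2
      exact Fin.ext (by omega)
    refine Prod.ext (funext fun l => ?_) ha
    rcases eq_or_ne l k with rfl | hl
    · exact hfk
    · exact hoff l hl
  simpa [Finset.card_product] using hle

theorem exists_norm_le_mul_abs_coord {d : ℕ} (hd : 0 < d) (u : EuclideanSpace ℝ (Fin d)) :
    ∃ k, ‖u‖ ≤ d * |u k| := by
  obtain ⟨k, -, hk⟩ := Finset.exists_le_of_sum_le (s := Finset.univ)
    (f := fun _ : Fin d => ‖u‖ ^ 2) (g := fun k => (d : ℝ) * u k ^ 2)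
    (Finset.univ_nonempty_iff.mpr ⟨⟨0, hd⟩⟩)
    (by rw [← Finset.mul_sum, EuclideanSpace.real_norm_sq_eq]; simp)
  refine ⟨k, abs_le_of_sq_le_sq' ?_ (by positivity) |>.2⟩
  have h1 : (1 : ℝ) ≤ d := by exact_mod_cast hd
  rw [mul_pow, sq_abs]
  nlinarith [sq_nonneg (u k), mul_nonneg (sub_nonneg.mpr h1) (sq_nonneg (u k))]

/-- Union bound over integer vectors with entries below `M = N²`, where `N` is the number of points:
each pair of distinct points rules out a fraction at most `1/M` of the vectors, and there are only
`N (N - 1) < M` ordered pairs. -/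
theorem exists_projection {d : ℕ} (hd : 0 < d) {X : Finset (EuclideanSpace ℝ (Fin d))}
    (hX : X.Nonempty) {μ Δ : ℝ} (hμ : 0 < μ) (hΔ : 0 < Δ)
    (hlo : ∀ x ∈ X, ∀ x' ∈ X, x ≠ x' → μ ≤ dist x x')
    (hhi : ∀ x ∈ X, ∀ x' ∈ X, x ≠ x' → dist x x' ≤ Δ * μ) :
    ∃ (v : Fin d → ℝ) (b : ℝ), OneSeparated (fun x : X => v ⬝ᵥ x.1 + b) ∧
      (∀ x : X, 0 ≤ v ⬝ᵥ x.1 + b) ∧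
      ∀ x : X, v ⬝ᵥ x.1 + b ≤ 2 * (d : ℝ) ^ 2 * Δ * (X.card : ℝ) ^ 2 := by
  classical
  have hdR : (0 : ℝ) < d := by exact_mod_cast hd
  have hN : 0 < X.card := hX.card_pos
  set M := X.card ^ 2 with hM
  let s : ℝ := μ / (2 * d)
  have hs : 0 < s := by positivity
  let bad : Finset (Fin d → Fin M) := X.offDiag.biUnion fun p =>
    Finset.univ.filter fun f => |∑ l, ((f l : ℕ) : ℝ) * (p.1 - p.2) l| < s
  have hbad : bad.card * M ≤ X.offDiag.card * M ^ d := by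
    refine (Nat.mul_le_mul_right _ Finset.card_biUnion_le).trans ?_
    rw [Finset.sum_mul, ← smul_eq_mul (X.offDiag.card)]
    refine Finset.sum_le_card_nsmul _ _ _ fun p hp => ?_
    obtain ⟨h1, h2, h3⟩ := Finset.mem_offDiag.mp hp
    obtain ⟨k, hk⟩ := exists_norm_le_mul_abs_coord hd (p.1 - p.2)
    refine card_slab_mul_le _ k ?_
    have := hlo _ h1 _ h2 h3
    rw [dist_eq_norm] at this
    have h4 : 2 * s = μ / d := by simp only [s]; field_simp
    rw [h4, div_le_iff₀ hdR]
    linarith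
  have hlt : bad.card < (Finset.univ : Finset (Fin d → Fin M)).card := by
    have hMpos : 0 < M := by positivity
    have h1 : X.offDiag.card < M := by
      rw [Finset.offDiag_card, hM, sq]
      exact Nat.sub_lt (by positivity) hN
    have h2 : bad.card * M < M ^ d * M := by
      refine hbad.trans_lt ?_
      rw [mul_comm]
      exact Nat.mul_lt_mul_of_pos_left h1 (by positivity)
    simpa using Nat.lt_of_mul_lt_mul_right h2
  obtain ⟨f, -, hf⟩ := Finset.exists_mem_notMem_of_card_lt_card hlt
  have hfar : ∀ x ∈ X, ∀ x' ∈ X, x ≠ x' → s ≤ |∑ l, ((f l : ℕ) : ℝ) * (x - x') l| := by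
    intro x hx x' hx' hne
    by_contra hcon
    exact hf (Finset.mem_biUnion.mpr ⟨(x, x'), Finset.mem_offDiag.mpr ⟨hx, hx', hne⟩,
      Finset.mem_filter.mpr ⟨Finset.mem_univ _, not_le.mp hcon⟩⟩)
  let v : Fin d → ℝ := fun l => s⁻¹ * ((f l : ℕ) : ℝ)
  have hv : ∀ x x' : EuclideanSpace ℝ (Fin d),
      v ⬝ᵥ x - v ⬝ᵥ x' = s⁻¹ * ∑ l, ((f l : ℕ) : ℝ) * (x - x') l := by
    intro x x'
    simp only [v, dotProduct, Finset.mul_sum, ← Finset.sum_sub_distrib, PiLp.sub_apply]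
    exact Finset.sum_congr rfl fun l _ => by ring
  obtain ⟨x₀, hx₀, hmin⟩ := X.exists_min_image (fun x => v ⬝ᵥ x) hX
  refine ⟨v, -(v ⬝ᵥ x₀), fun x x' hne => ?_, fun x => ?_, fun x => ?_⟩
  · rw [add_sub_add_right_eq_sub, hv, abs_mul, abs_of_pos (inv_pos.mpr hs),
      ← inv_mul_cancel₀ hs.ne']
    exact mul_le_mul_of_nonneg_left (hfar _ x.2 _ x'.2 fun h => hne (Subtype.ext h))
      (inv_pos.mpr hs).le
  · linarith [hmin x x.2]
  · rw [← sub_eq_add_neg, hv]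
    have hnorm : ‖(x : EuclideanSpace ℝ (Fin d)) - x₀‖ ≤ Δ * μ := by
      rcases eq_or_ne (x : EuclideanSpace ℝ (Fin d)) x₀ with h | h
      · rw [h, sub_self, norm_zero]
        positivity
      · rw [← dist_eq_norm]
        exact hhi _ x.2 _ hx₀ h
    have hsum : ∑ l, ((f l : ℕ) : ℝ) * ((x : EuclideanSpace ℝ (Fin d)) - x₀) l ≤
        d * ((M : ℝ) * (Δ * μ)) := by
      have : ∀ l ∈ (Finset.univ : Finset (Fin d)),
          ((f l : ℕ) : ℝ) * ((x : EuclideanSpace ℝ (Fin d)) - x₀) l ≤ (M : ℝ) * (Δ * μ) := by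
        intro l _
        have h1 : ((f l : ℕ) : ℝ) ≤ M := by exact_mod_cast (f l).2.le
        have h2 := (Real.norm_eq_abs _ ▸ PiLp.norm_apply_le
          ((x : EuclideanSpace ℝ (Fin d)) - x₀) l).trans hnorm
        exact (mul_le_mul_of_nonneg_left ((le_abs_self _).trans h2) (Nat.cast_nonneg _)).trans
          (mul_le_mul_of_nonneg_right h1 (by positivity))
      simpa using Finset.sum_le_card_nsmul _ _ _ this
    calc _ ≤ s⁻¹ * (d * ((M : ℝ) * (Δ * μ))) :=
          mul_le_mul_of_nonneg_left hsum (inv_pos.mpr hs).le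
      _ = _ := by
          simp only [s, hM]
          push_cast
          field_simp

/-! ### Reading selected digits of a stored word -/

/-- The real number in `[0, 1)` with the `T` digits `d 0, d 1, …` after the point in base `Q`. -/
noncomputable def digitWord (Q : ℕ) : ℕ → (ℕ → ℕ) → ℝ
  | 0, _ => 0
  | T + 1, d => (d 0 + digitWord Q T fun t => d (t + 1)) / Q

theorem digitWord_mem_Ico {Q : ℕ} (T : ℕ) {d : ℕ → ℕ} (hd : ∀ t, d t < Q) :
    digitWord Q T d ∈ Set.Ico (0 : ℝ) 1 := by
  induction T generalizing d with
  | zero => simp [digitWord]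
  | succ T ih =>
    obtain ⟨h0, h1⟩ := ih (d := fun t => d (t + 1)) fun t => hd _
    have hQ : (0 : ℝ) < Q := by exact_mod_cast (Nat.zero_le _).trans_lt (hd 0)
    have hd0 : (d 0 : ℝ) + 1 ≤ Q := by exact_mod_cast hd 0
    refine ⟨div_nonneg (by positivity) hQ.le, (div_lt_one hQ).mpr ?_⟩
    linarith

/-- The digit `d` if the position `r` agrees with `p`; otherwise `Q - 1` for `r < p` and `0` for
`r > p`. -/
def gatedDigit (Q p r d : ℕ) : ℕ := if r = p then d else if r < p then Q - 1 else 0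

/-- A step unit sees a single linear form and cannot multiply a digit by a position test.
Subtracting `Q (r - p)` replaces the product: it pushes the value out of `[0, Q)` unless `r = p`,
and clamping leaves a constant independent of the digit. -/
theorem min_floor_eq_gatedDigit {Q p r d : ℕ} (hd : d < Q) {x : ℝ} (hx : x ∈ Set.Ico (0 : ℝ) 1) :
    min (Q - 1) ⌊(d + x) - Q * r + Q * p⌋₊ = gatedDigit Q p r d := by
  have hdQ : (d : ℝ) + 1 ≤ Q := by exact_mod_cast hd
  obtain ⟨hx0, hx1⟩ := hx
  unfold gatedDigit
  split_ifs with h1 h2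
  · subst h1
    have h2 : ⌊(d : ℝ) + x⌋₊ = d :=
      (Nat.floor_eq_iff (by positivity)).mpr ⟨by linarith, by linarith⟩
    rw [sub_add_cancel, h2]
    omega
  · have h3 : (r : ℝ) + 1 ≤ p := by exact_mod_cast h2
    have h4 : Q ≤ ⌊(d + x) - Q * r + Q * p⌋₊ := by
      apply Nat.le_floor
      nlinarith [Nat.cast_nonneg (α := ℝ) d, Nat.cast_nonneg (α := ℝ) Q]
    omega
  · have h3 : (p : ℝ) + 1 ≤ r := by
      have : p + 1 ≤ r := by omega
      exact_mod_cast this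
    rw [Nat.floor_of_nonpos, Nat.min_zero]
    nlinarith [Nat.cast_nonneg (α := ℝ) Q]

/-- Each layer uses two tables of size `Q`: one removes the leading digit from the word, the other
adds the weighted gated digit to the accumulator. -/
theorem StepChain.extract {ι : Type} [Finite ι] {Q : ℕ} {es : List ℕ} {y : ι → ℝ} {r : ι → ℕ}
    (T : ℕ) {d : ι → ℕ → ℕ} (hd : ∀ i t, d i t < Q) (p : ℕ → ℕ) (ω : ℕ → ℝ) {a : ι → ℝ}
    (h : StepChain es (fun i => ![a i + ∑ t ∈ Finset.range T,
      ω t * (gatedDigit Q (p t) (r i) (d i t) : ℝ), 0, (r i : ℝ)]) y) :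
    StepChain (List.replicate T (Q + Q) ++ es)
      (fun i => ![a i, digitWord Q T (d i), (r i : ℝ)]) y := by
  induction T generalizing d p ω a with
  | zero => simpa [digitWord] using h
  | succ T ih =>
    have hword : ∀ i, (Q : ℝ) * digitWord Q (T + 1) (d i) =
        d i 0 + digitWord Q T (fun t => d i (t + 1)) := by
      intro i
      have hQ : (Q : ℝ) ≠ 0 := by exact_mod_cast ((Nat.zero_le _).trans_lt (hd i 0)).ne'
      simp only [digitWord]
      field_simp
    have hmem := fun i => digitWord_mem_Ico T (d := fun t => d i (t + 1)) fun t => hd i _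
    refine StepChain.cons (T := fun i => ![a i + ω 0 * (gatedDigit Q (p 0) (r i) (d i 0) : ℝ),
      digitWord Q T (fun t => d i (t + 1)), (r i : ℝ)]) ?_ ?_
    · refine StepLayer.of_tables !![1, 0, 0; 0, Q, 0; 0, 0, 1] ![0, 1, 0] ![0, Q, -Q]
        (β₁ := fun i => d i 0) (β₂ := fun i => gatedDigit Q (p 0) (r i) (d i 0))
        (fun i j hij => ?_) (fun i j hij => ?_) (fun i => (hd i 0).le) (fun i => ?_)
        (fun b => ![0, -b, 0]) (fun b => ![ω 0 * b, 0, 0]) (fun i j => ?_)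
      · simp only [dotProduct, Fin.sum_univ_three, Matrix.cons_val_zero, Matrix.cons_val_one,
          Matrix.cons_val, zero_mul, one_mul, zero_add, add_zero] at hij
        have h1 := mul_le_mul_of_nonneg_left hij (Nat.cast_nonneg (α := ℝ) Q)
        rw [hword, hword] at h1
        have h2 : (d i 0 : ℝ) < d j 0 + 1 := by linarith [(hmem i).1, (hmem j).2]
        exact Nat.lt_succ_iff.mp (by exact_mod_cast h2)
      · simp only [dotProduct, Fin.sum_univ_three, Matrix.cons_val_zero, Matrix.cons_val_one,
          Matrix.cons_val, zero_mul, zero_add] at hij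
        rw [hword, hword] at hij
        rw [← min_floor_eq_gatedDigit (hd i 0) (hmem i), ← min_floor_eq_gatedDigit (hd j 0) (hmem j)]
        refine min_le_min le_rfl (Nat.floor_mono ?_)
        linarith
      · have := hd i 0
        unfold gatedDigit
        split_ifs <;> omega
      · have := hword i
        fin_cases j <;> simp [Matrix.mulVec, dotProduct, Fin.sum_univ_three]
        linarith
    · refine ih (fun i t => hd i _) (fun t => p (t + 1)) (fun t => ω (t + 1)) ?_
      convert h using 3 with i
      rw [Finset.sum_range_succ', add_assoc, add_comm (ω 0 * _)]

theorem sum_range_mul_divMod {h : ℕ} (hh : 0 < h) (P : ℕ) (F : ℕ → ℕ → ℝ) :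
    ∑ t ∈ Finset.range (P * h), F (t / h) (t % h) =
      ∑ p ∈ Finset.range P, ∑ i ∈ Finset.range h, F p i := by
  induction P with
  | zero => simp
  | succ P ih =>
    rw [add_mul, one_mul, Finset.sum_range_add, ih, Finset.sum_range_succ]
    congr 1
    refine Finset.sum_congr rfl fun x hx => ?_
    have hx' := Finset.mem_range.mp hx
    rw [mul_comm P h, Nat.mul_add_div hh, Nat.div_eq_of_lt hx', Nat.mul_add_mod,
      Nat.mod_eq_of_lt hx', add_zero]

theorem sum_range_digits (Q V h : ℕ) :
    ∑ i ∈ Finset.range h, Q ^ i * (V / Q ^ i % Q) = V % Q ^ h := by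
  induction h with
  | zero => simp [Nat.mod_one]
  | succ h ih => rw [Finset.sum_range_succ, ih, Nat.mod_pow_succ]

/-- The saturated digits at wrong positions contribute an amount that depends only on `r`, so it can
be subtracted in advance; the digits at position `r` reassemble `g * V`. -/
theorem sum_gatedDigit {Q h P r V g : ℕ} (hh : 0 < h) (hr : r < P) (hV : V < Q ^ h)
    (W : ℕ → ℕ) (hW : W r = V) :
    ∑ t ∈ Finset.range (P * h), ((g : ℝ) * Q ^ (t % h)) *
        (gatedDigit Q (t / h) r (W (t / h) / Q ^ (t % h) % Q) : ℝ) =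
      g * V + ∑ t ∈ Finset.range (P * h), ((g : ℝ) * Q ^ (t % h)) *
        (gatedDigit Q (t / h) r 0 : ℝ) := by
  have hsplit : ∀ p d, (gatedDigit Q p r d : ℝ) =
      (if p = r then (d : ℝ) else 0) + gatedDigit Q p r 0 := by
    intro p d
    unfold gatedDigit
    rcases eq_or_ne r p with rfl | hne
    · simp
    · simp [hne, hne.symm]
  simp only [fun t => hsplit (t / h) (W (t / h) / Q ^ (t % h) % Q), mul_add,
    Finset.sum_add_distrib]
  congr 1
  rw [sum_range_mul_divMod hh P (fun p i => (g : ℝ) * Q ^ i *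
    (if p = r then ((W p / Q ^ i % Q : ℕ) : ℝ) else 0)), Finset.sum_eq_single r]
  · simp only [if_true, hW, mul_assoc, ← Finset.mul_sum]
    congr 1
    have := sum_range_digits Q V h
    rw [Nat.mod_eq_of_lt hV] at this
    exact_mod_cast this
  · intro p _ hp
    simp [hp]
  · intro h'
    exact absurd (Finset.mem_range.mpr hr) h'

theorem StepChain.lookup {ι : Type} [Finite ι] {A P g h Q : ℕ} (hP : 0 < P) (hg : 0 < g)
    (hh : 0 < h) (hQ : 0 < Q) {z : ι → ℝ} (hzA : ∀ i, z i < A * (P * g : ℕ))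
    (V : ℕ → ℕ → ℕ) (hV : ∀ q p, V q p < Q ^ h) {es : List ℕ} {y : ι → ℝ}
    (hes : StepChain es (fun i => ![(g : ℝ) * V (⌊z i⌋₊ / (P * g)) (⌊z i⌋₊ % (P * g) / g) +
      (⌊z i⌋₊ % (P * g) % g : ℕ), 0, (⌊z i⌋₊ % (P * g) / g : ℕ)]) y) :
    StepChain (A :: P * g :: (List.replicate (P * h) (Q + Q) ++ es)) (fun i => ![z i, 0, 0]) y := by
  have hB : 0 < P * g := Nat.mul_pos hP hg
  have hBR : (0 : ℝ) < (P * g : ℕ) := by exact_mod_cast hB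
  let D : ℕ → ℕ → ℕ := fun q t => V q (t / h) / Q ^ (t % h) % Q
  have hdiv : ∀ i, ⌊z i⌋₊ / (P * g) = ⌊z i / (P * g : ℕ)⌋₊ := fun i =>
    (Nat.floor_div_natCast _ _).symm
  let q : ι → ℕ := fun i => ⌊z i⌋₊ / (P * g)
  have hrem : ∀ i, ⌊z i⌋₊ % (P * g) = ⌊z i - (P * g : ℕ) * (q i : ℝ)⌋₊ := by
    intro i
    rw [← Nat.cast_mul, Nat.floor_sub_natCast]
    have := Nat.div_add_mod ⌊z i⌋₊ (P * g)
    change _ = _ - P * g * (⌊z i⌋₊ / (P * g))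
    omega
  -- The first layer finds the block, moves it to the origin and loads its word.
  refine StepChain.cons (T := fun i => ![z i - (P * g : ℕ) * (q i : ℝ),
    digitWord Q (P * h) (D (q i)), 0]) ?_ ?_
  · refine StepLayer.of_table !![1, 0, 0; 0, 0, 0; 0, 0, 0] ![1, 0, 0] (β := q)
      (fun i j hij => ?_) (fun i => ?_)
      (fun b => ![-((P * g : ℕ) * (b : ℝ)), digitWord Q (P * h) (D b), 0]) (fun i j => ?_)
    · have hij' : z i ≤ z j := by simpa [dotProduct, Fin.sum_univ_three] using hij
      exact Nat.div_le_div_right (Nat.floor_mono hij')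
    · change ⌊z i⌋₊ / (P * g) ≤ A
      rw [hdiv]
      refine Nat.floor_le_of_le ?_
      rw [div_le_iff₀ hBR]
      exact (hzA i).le
    · fin_cases j <;> simp [Matrix.mulVec, dotProduct, Fin.sum_univ_three]
      ring
  -- The contribution of the saturated digits; the accumulator starts at minus this amount plus the
  -- offset inside the group.
  let E : ℕ → ℝ := fun r => ∑ t ∈ Finset.range (P * h), ((g : ℝ) * Q ^ (t % h)) *
    (gatedDigit Q (t / h) r 0 : ℝ)
  refine StepChain.cons (T := fun i => ![((⌊z i⌋₊ % (P * g) % g : ℕ) : ℝ) -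
    E (⌊z i⌋₊ % (P * g) / g), digitWord Q (P * h) (D (q i)),
    ((⌊z i⌋₊ % (P * g) / g : ℕ) : ℝ)]) ?_ ?_
  · refine StepLayer.of_table !![0, 0, 0; 0, 1, 0; 0, 0, 0] ![1, 0, 0]
      (β := fun i => ⌊z i⌋₊ % (P * g)) (fun i j hij => ?_) (fun i => (Nat.mod_lt _ hB).le)
      (fun b => ![((b % g : ℕ) : ℝ) - E (b / g), 0, ((b / g : ℕ) : ℝ)]) (fun i j => ?_)
    · rw [hrem, hrem]
      refine Nat.floor_mono ?_
      simpa only [dotProduct, Fin.sum_univ_three, Matrix.cons_val_zero, Matrix.cons_val_one,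
        Matrix.cons_val, zero_mul, one_mul, add_zero] using hij
    · fin_cases j <;> simp [Matrix.mulVec, dotProduct, Fin.sum_univ_three]
  refine StepChain.extract (P * h) (d := fun i => D (q i)) (fun i t => Nat.mod_lt _ hQ)
    (fun t => t / h) (fun t => (g : ℝ) * Q ^ (t % h)) ?_
  convert hes using 3 with i
  have hr : ⌊z i⌋₊ % (P * g) / g < P :=
    Nat.div_lt_of_lt_mul (by rw [mul_comm g P]; exact Nat.mod_lt _ hB)
  have := sum_gatedDigit (g := g) hh hr (hV (q i) _) (V (q i)) rfl
  simp only [D, this, E, q]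
  ring

/-! ### Coding the labels -/

theorem exists_digits_eq {C : ℕ} (g : ℕ) {f : ℕ → ℕ} (hf : ∀ j, f j < C) :
    ∃ V < C ^ g, ∀ j < g, V / C ^ j % C = f j := by
  induction g generalizing f with
  | zero => exact ⟨0, by simp, fun j hj => absurd hj (Nat.not_lt_zero _)⟩
  | succ g ih =>
    obtain ⟨V, hV, hdig⟩ := ih (f := fun j => f (j + 1)) fun j => hf _
    have hC : 0 < C := (Nat.zero_le _).trans_lt (hf 0)
    refine ⟨f 0 + C * V, ?_, fun j hj => ?_⟩
    · have h0 := hf 0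
      rw [pow_succ']
      calc f 0 + C * V < C * (V + 1) := by rw [mul_add, mul_one]; omega
        _ ≤ C * C ^ g := Nat.mul_le_mul_left _ hV
    · cases j with
      | zero => simp [Nat.mod_eq_of_lt (hf 0)]
      | succ j =>
        rw [pow_succ', ← Nat.div_div_eq_div_mul, Nat.add_mul_div_left _ _ hC,
          Nat.div_eq_of_lt (hf 0), zero_add]
        exact hdig j (by omega)

theorem OneSeparated.floor_injective {ι : Type} {z : ι → ℝ} (hz : OneSeparated z)
    (hz₀ : ∀ i, 0 ≤ z i) : Function.Injective fun i => ⌊z i⌋₊ := by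
  intro i j hij
  by_contra hne
  have hij' : ⌊z i⌋₊ = ⌊z j⌋₊ := hij
  have h1 := Nat.floor_le (hz₀ i)
  have h2 := Nat.lt_floor_add_one (z i)
  have h3 := Nat.floor_le (hz₀ j)
  have h4 := Nat.lt_floor_add_one (z j)
  rw [hij'] at h1 h2
  have := hz i j hne
  rcases le_abs.mp this with h | h <;> linarith

/-- Distinct integer parts make the label a function of the integer part. Every run of `g`
consecutive integers is packed into one number in base `C`, with arbitrary labels at unoccupied
integers. -/
theorem OneSeparated.exists_codebook {ι : Type} {z : ι → ℝ} (hz : OneSeparated z)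
    (hz₀ : ∀ i, 0 ≤ z i) {C P g : ℕ} {y : ι → ℕ} (hC : 0 < C) (hy : ∀ i, y i < C) (hg : 0 < g) :
    ∃ V : ℕ → ℕ → ℕ, (∀ q p, V q p < C ^ g) ∧ ∀ i,
      V (⌊z i⌋₊ / (P * g)) (⌊z i⌋₊ % (P * g) / g) / C ^ (⌊z i⌋₊ % (P * g) % g) % C = y i := by
  have : Nonempty (Fin C) := ⟨⟨0, hC⟩⟩
  obtain ⟨lab, hlab⟩ := exists_eq_comp_of_factors (fun i => ⌊z i⌋₊) (fun i => (⟨y i, hy i⟩ : Fin C))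
    fun i j hij => by rw [hz.floor_injective hz₀ hij]
  choose V hV hdig using fun q p => exists_digits_eq g
    (f := fun j => (lab (P * g * q + (g * p + j)) : ℕ)) fun j => (lab _).2
  refine ⟨V, hV, fun i => ?_⟩
  rw [hdig _ _ _ (Nat.mod_lt _ hg), Nat.div_add_mod, Nat.div_add_mod, hlab]

/-- For large `C`: one label is spread over `h` digits in base `Q`. -/
theorem OneSeparated.stepChain_direct {ι : Type} [Finite ι] {z : ι → ℝ} (hz : OneSeparated z)
    (hz₀ : ∀ i, 0 ≤ z i) {A P C h Q : ℕ} (hP : 0 < P) (hh : 0 < h) (hQ : 0 < Q) (hC : 0 < C)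
    (hzA : ∀ i, z i < A * P) (hCQ : C ≤ Q ^ h) {y : ι → ℕ} (hy : ∀ i, y i < C) :
    StepChain (A :: P :: List.replicate (P * h) (Q + Q)) (fun i => ![z i, 0, 0])
      (fun i => (y i : ℝ)) := by
  obtain ⟨V, hV, hdec⟩ := hz.exists_codebook hz₀ (P := P) (g := 1) hC hy one_pos
  have := StepChain.lookup (g := 1) (A := A) (es := []) (y := fun i => (y i : ℝ)) hP one_pos hh hQ
    (by simpa using hzA) V (fun q p => (hV q p).trans_le (by simpa using hCQ))
    (StepChain.nil _ _ fun i => ?_)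
  · simpa using this
  · have h1 := hdec i
    rw [Nat.mod_one, pow_zero, Nat.div_one, Nat.mod_eq_of_lt (by simpa using hV _ _)] at h1
    simp only [Matrix.cons_val_zero, h1, Nat.mod_one]
    simp

/-- For small `C`: one digit in base `Q` holds `g` labels. The extracted value `g * v + j`
determines both the digit and the place inside it, so a last table with `Q * g` steps decodes the
label. -/
theorem OneSeparated.stepChain_grouped {ι : Type} [Finite ι] {z : ι → ℝ} (hz : OneSeparated z)
    (hz₀ : ∀ i, 0 ≤ z i) {A P C g Q : ℕ} (hP : 0 < P) (hg : 0 < g) (hQ : 0 < Q) (hC : 0 < C)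
    (hzA : ∀ i, z i < A * (P * g : ℕ)) (hCQ : C ^ g ≤ Q) {y : ι → ℕ} (hy : ∀ i, y i < C) :
    StepChain (A :: P * g :: (List.replicate P (Q + Q) ++ [Q * g])) (fun i => ![z i, 0, 0])
      (fun i => (y i : ℝ)) := by
  obtain ⟨V, hV, hdec⟩ := hz.exists_codebook hz₀ (P := P) hC hy hg
  have hVQ : ∀ q p, V q p < Q ^ 1 := fun q p => (hV q p).trans_le (by simpa using hCQ)
  have := StepChain.lookup (h := 1) (A := A) (es := [Q * g]) (y := fun i => (y i : ℝ)) hP hg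
    one_pos hQ hzA V hVQ (StepChain.cons (T := fun i => ![(y i : ℝ), 0, 0]) ?_
      (StepChain.nil _ _ fun i => rfl))
  · simpa using this
  · let v : ι → ℕ := fun i => V (⌊z i⌋₊ / (P * g)) (⌊z i⌋₊ % (P * g) / g)
    let j : ι → ℕ := fun i => ⌊z i⌋₊ % (P * g) % g
    have hj : ∀ i, j i < g := fun i => Nat.mod_lt _ hg
    refine StepLayer.of_table 0 ![1, 0, 0] (β := fun i => g * v i + j i) (fun a b hab => ?_)
      (fun i => ?_) (fun b => ![((b / g / C ^ (b % g) % C : ℕ) : ℝ), 0, 0]) (fun i l => ?_)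
    · simp only [dotProduct, Fin.sum_univ_three, Matrix.cons_val_zero, Matrix.cons_val_one,
        Matrix.cons_val, zero_mul, one_mul, add_zero] at hab
      exact_mod_cast hab
    · have h1 : v i + 1 ≤ Q := by simpa using hVQ _ _
      have h2 := hj i
      nlinarith [Nat.mul_le_mul_left g h1]
    · have h1 : (g * v i + j i) / g = v i := by
        rw [Nat.mul_add_div hg, Nat.div_eq_of_lt (hj i), add_zero]
      have h2 : (g * v i + j i) % g = j i := by
        rw [Nat.mul_add_mod, Nat.mod_eq_of_lt (hj i)]
      rw [h1, h2, hdec i]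
      fin_cases l <;> simp

/-! ### Separated sets and assembly of the network -/

theorem IsSeparated.exists_dist_bounds {dx : ℕ} {Δ : ℝ}
    {X : Finset (EuclideanSpace ℝ (Fin dx))} (hX : 2 ≤ X.card)
    (h : IsSeparated Δ (X : Set (EuclideanSpace ℝ (Fin dx)))) :
    ∃ μ : ℝ, 0 < μ ∧ (∀ x ∈ X, ∀ x' ∈ X, x ≠ x' → μ ≤ dist x x') ∧
      ∀ x ∈ X, ∀ x' ∈ X, x ≠ x' → dist x x' ≤ Δ * μ := by
  unfold IsSeparated at h
  set I := ⨅ (x ∈ (X : Set (EuclideanSpace ℝ (Fin dx)))) (x' ∈ (X : Set (EuclideanSpace ℝ (Fin dx))))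
    (_ : x ≠ x'), edist x x' with hI
  have hlo : ∀ x ∈ X, ∀ x' ∈ X, x ≠ x' → I ≤ edist x x' := fun x hx x' hx' hne =>
    iInf₂_le_of_le x hx (iInf₂_le_of_le x' hx' (iInf_le _ hne))
  have hhi : ∀ x ∈ X, ∀ x' ∈ X, x ≠ x' → edist x x' ≤ ENNReal.ofReal Δ * I :=
    fun x hx x' hx' hne => le_trans (le_iSup₂_of_le x hx (le_iSup₂_of_le x' hx'
      (le_iSup (fun _ : x ≠ x' => edist x x') hne))) h.le
  obtain ⟨a, ha, b, hb, hab⟩ := Finset.one_lt_card.mp hX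
  have hI_top : I ≠ ⊤ := ne_top_of_le_ne_top (edist_ne_top a b) (hlo a ha b hb hab)
  have hI_pos : I ≠ 0 := fun h0 => by
    rw [h0, mul_zero] at h
    exact not_lt_bot h
  have hΔ : 0 ≤ Δ := by
    by_contra hneg
    rw [ENNReal.ofReal_of_nonpos (not_le.mp hneg).le, zero_mul] at h
    exact not_lt_bot h
  refine ⟨I.toReal, ENNReal.toReal_pos hI_pos hI_top, fun x hx x' hx' hne => ?_,
    fun x hx x' hx' hne => ?_⟩
  · rw [dist_edist]
    exact ENNReal.toReal_mono (edist_ne_top _ _) (hlo x hx x' hx' hne)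
  · have := ENNReal.toReal_mono (ENNReal.mul_ne_top ENNReal.ofReal_ne_top hI_top)
      (hhi x hx x' hx' hne)
    rwa [ENNReal.toReal_mul, ENNReal.toReal_ofReal hΔ, ← dist_edist] at this

/-- Among three points on a line, the outer distance is the sum of the two gaps. The depth bound has
no additive constant, and this supplies `log Δ ≥ 1` when `d_x = 1` and `N ≥ 3`. -/
theorem IsSeparated.two_le_of_dim_one {Δ : ℝ} {X : Finset (EuclideanSpace ℝ (Fin 1))}
    (hX : 3 ≤ X.card) (h : IsSeparated Δ (X : Set (EuclideanSpace ℝ (Fin 1)))) : 2 ≤ Δ := by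
  obtain ⟨μ, hμ, hlo, hhi⟩ := h.exists_dist_bounds (by omega)
  obtain ⟨a, b, c, ha, hb, hc, hab, hac, hbc⟩ := Finset.two_lt_card_iff.mp hX
  have hdist : ∀ x x' : EuclideanSpace ℝ (Fin 1), dist x x' = |x 0 - x' 0| := by
    intro x x'
    rw [EuclideanSpace.dist_eq]
    simp [Real.dist_eq, Real.sqrt_sq_eq_abs]
  have h1 := hlo a ha b hb hab
  have h2 := hlo a ha c hc hac
  have h3 := hlo b hb c hc hbc
  have h4 := hhi a ha b hb hab
  have h5 := hhi a ha c hc hac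
  have h6 := hhi b hb c hc hbc
  rw [hdist] at h1 h2 h3 h4 h5 h6
  by_contra hlt
  have h7 : Δ * μ < 2 * μ := mul_lt_mul_of_pos_right (not_le.mp hlt) hμ
  rcases abs_cases (a 0 - b 0) with ⟨e1, _⟩ | ⟨e1, _⟩ <;>
    rcases abs_cases (a 0 - c 0) with ⟨e2, _⟩ | ⟨e2, _⟩ <;>
    rcases abs_cases (b 0 - c 0) with ⟨e3, _⟩ | ⟨e3, _⟩ <;>
    rw [e1] at h1 h4 <;> rw [e2] at h2 h5 <;> rw [e3] at h3 h6 <;> linarith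

theorem canMemorize_of_constant (σ : ℝ → ℝ) {dx C : ℕ} {X : Finset (EuclideanSpace ℝ (Fin dx))}
    {y : X → Fin C} (h : ∀ x x', y x = y x') : CanMemorize σ dx [] X y := by
  intro ε hε
  rcases isEmpty_or_nonempty X with hX | ⟨⟨x₀⟩⟩
  · exact ⟨((0 : Fin dx → ℝ), (0 : ℝ)), fun x => isEmptyElim x⟩
  · refine ⟨((0 : Fin dx → ℝ), ((y x₀ : ℕ) : ℝ)), fun x => ?_⟩
    rw [h x x₀]
    change |∑ j, (0 : Fin dx → ℝ) j * x.1 j + ((y x₀ : ℕ) : ℝ) - ((y x₀ : ℕ) : ℝ)| ≤ ε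
    simpa using hε.le

theorem canMemorize_of_stepChain {σ : ℝ → ℝ} (hσ : IsSigmoidal σ ∨ σ = relu) {dx C : ℕ}
    (hdx : 0 < dx) {X : Finset (EuclideanSpace ℝ (Fin dx))} (hX : 2 ≤ X.card) {y : X → Fin C}
    {Δ : ℝ} (hΔ : 1 ≤ Δ) (hsep : IsSeparated Δ (X : Set (EuclideanSpace ℝ (Fin dx))))
    {L J₁ J₂ n S : ℕ} {ℓ : ℝ} (hL : (dx : ℝ) ^ 2 * Δ ≤ 2 ^ L) (hℓ : 0 < ℓ)
    (hJ₁ : 10 * (X.card : ℝ) ^ 2 ≤ ℓ * (J₁ + 1)) (hn : 0 < n) (hJ₂ : X.card ≤ n * (J₂ + 1))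
    (hS : 2 * n * X.card < S) {es : List ℕ}
    (hes : ∀ z : X → ℝ, OneSeparated z → (∀ i, 0 ≤ z i) → (∀ i, z i < ℓ + S) →
      StepChain es (fun i => ![z i, 0, 0]) (fun i => ((y i : ℕ) : ℝ))) :
    CanMemorize σ dx (chainArchitecture (List.replicate L 1 ++ (J₁ + J₂) :: es)) X y := by
  have hne : X.Nonempty := Finset.card_pos.mp (by omega)
  have : Nonempty X := hne.to_subtype
  have hcard : Fintype.card X = X.card := Fintype.card_coe X
  have hN : (0 : ℝ) < X.card := by exact_mod_cast hne.card_pos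
  have hdR : (0 : ℝ) < dx := by exact_mod_cast hdx
  obtain ⟨μ, hμ, hlo, hhi⟩ := hsep.exists_dist_bounds hX
  obtain ⟨v, b, hv, hv₀, hvK⟩ := exists_projection hdx hne hμ (by linarith) hlo hhi
  refine canMemorize_chainArchitecture hσ v b ?_
  -- The projection bound is doubled to obtain a strict inequality. After `L` halvings at most `4 N²
  -- + 6 N² = 10 N²` remains.
  refine StepChain.halving L (K := 4 * (dx : ℝ) ^ 2 * Δ * (X.card : ℝ) ^ 2) (by positivity)
    (fun z hz hz₀ hzK => ?_) hv hv₀ fun i => ?_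
  · have hle : 4 * (dx : ℝ) ^ 2 * Δ * (X.card : ℝ) ^ 2 / 2 ^ L ≤ 4 * (X.card : ℝ) ^ 2 := by
      rw [div_le_iff₀ (by positivity)]
      nlinarith [mul_le_mul_of_nonneg_left hL (show 0 ≤ 4 * (X.card : ℝ) ^ 2 by positivity)]
    rw [hcard] at hzK
    obtain ⟨z', hz', hz₀', hzK', hlayer⟩ := exists_hash_layer hz hz₀ hℓ (J₁ := J₁) (J₂ := J₂)
      (n := n) (S := S) (fun i => (hzK i).trans_le (by linarith)) hn (by rwa [hcard])
      (by rwa [hcard])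
    exact StepChain.cons hlayer (hes z' hz' hz₀' hzK')
  · refine (hvK i).trans_lt ?_
    rw [hcard]
    have : 0 < (dx : ℝ) ^ 2 * Δ * (X.card : ℝ) ^ 2 := by positivity
    nlinarith [sq_pos_of_pos hN]

/-! ### Choice of sizes and final bounds -/

theorem two_rpow_logb {a : ℝ} (ha : 0 < a) : (2 : ℝ) ^ Real.logb 2 a = a :=
  Real.rpow_logb two_pos (by norm_num) ha

set_option maxHeartbeats 1000000 in
theorem exists_lookup_chain {N C : ℕ} (hN : 2 ≤ N) (hC : 2 ≤ C) {w : ℝ}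
    (hw : w ∈ Set.Icc (2 / 3 : ℝ) 1) :
    ∃ es : List ℕ,
      (es.length : ℝ) ≤ 4 + 4 * ((N : ℝ) ^ (2 - 2 * w) / (1 + (1.5 * w - 1) * Real.logb 2 N) *
        Real.logb 2 C) ∧
      (es.sum : ℝ) ≤ 18 * (N : ℝ) ^ w + 24 * ((N : ℝ) ^ (1 - w / 2) * Real.logb 2 C) ∧
      ∀ {ι : Type} [Finite ι] (z : ι → ℝ) (y : ι → ℕ), OneSeparated z → (∀ i, 0 ≤ z i) →
        (∀ i, z i < 6 * (N : ℝ) ^ (2 - w)) → (∀ i, y i < C) →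
        StepChain es (fun i => ![z i, 0, 0]) (fun i => (y i : ℝ)) := by
  obtain ⟨hw1, hw2⟩ := hw
  have hNR : (2 : ℝ) ≤ N := by exact_mod_cast hN
  have hN1 : (1 : ℝ) ≤ N := by linarith
  have hN0 : (0 : ℝ) < N := by linarith
  have hCR : (2 : ℝ) ≤ C := by exact_mod_cast hC
  have hC0 : (0 : ℝ) < C := by linarith
  set c := Real.logb 2 (C : ℝ) with hc
  set k := 1 + (1.5 * w - 1) * Real.logb 2 (N : ℝ) with hk
  set D := (N : ℝ) ^ (2 - 2 * w) with hD
  set q := (N : ℝ) ^ (1.5 * w - 1) with hq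
  set x := (N : ℝ) ^ w with hx
  have hc1 : 1 ≤ c := by
    rw [hc, Real.le_logb_iff_rpow_le (by norm_num) hC0]
    simpa using hCR
  have hlogN : 0 ≤ Real.logb 2 (N : ℝ) := Real.logb_nonneg (by norm_num) hN1
  have hk1 : 1 ≤ k := by
    have : 0 ≤ (1.5 * w - 1) * Real.logb 2 (N : ℝ) := mul_nonneg (by linarith) hlogN
    linarith
  have h2k : (2 : ℝ) ^ k = 2 * q := by
    rw [hk, Real.rpow_add two_pos, Real.rpow_one, mul_comm (1.5 * w - 1), Real.rpow_mul two_pos.le,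
      two_rpow_logb hN0]
  have h2c : (2 : ℝ) ^ c = C := two_rpow_logb hC0
  have hq1 : 1 ≤ q := Real.one_le_rpow hN1 (by linarith)
  have hD1 : 1 ≤ D := Real.one_le_rpow hN1 (by linarith)
  have hx1 : 1 ≤ x := Real.one_le_rpow hN1 (by linarith)
  have hDx : D ≤ x := Real.rpow_le_rpow_of_exponent_le hN1 (by linarith)
  -- This pays for the decoding table of the grouped case, and it is where `w ≤ 1` enters: `3w - 2 ≤
  -- w`.
  have hqx : q * q ≤ x := by
    rw [hq, ← Real.rpow_add hN0]
    exact Real.rpow_le_rpow_of_exponent_le hN1 (by linarith)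
  have hDq : (N : ℝ) ^ (1 - w / 2) = D * q := by
    rw [hD, hq, ← Real.rpow_add hN0]
    congr 1
    ring
  have hxD : (N : ℝ) ^ (2 - w) = x * D := by
    rw [hD, hx, ← Real.rpow_add hN0]
    congr 1
    ring
  have hkq : k ≤ 2 * q := by
    have := one_add_mul_self_le_rpow_one_add (s := 1) (by norm_num) hk1
    rw [one_add_one_eq_two, h2k] at this
    linarith
  have hqle : q ≤ x := by nlinarith
  rw [hDq, hxD]
  have hA : ((⌈6 * x⌉₊ : ℕ) : ℝ) ≤ 7 * x := by
    linarith [Nat.ceil_lt_add_one (show 0 ≤ 6 * x by linarith)]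
  have hA' : 6 * x ≤ (⌈6 * x⌉₊ : ℕ) := Nat.le_ceil _
  have hDck : D / k * c ≤ D * c := by
    rw [div_mul_eq_mul_div]
    exact div_le_self (by positivity) hk1
  have hDck0 : 0 ≤ D / k * c := by positivity
  -- A digit carries about `k` bits and a label `c` bits, which decides between grouping labels and
  -- splitting them.
  rcases le_or_gt c k with hck | hck
  · set g := ⌊k / c⌋₊ with hg
    have hkc : 1 ≤ k / c := (one_le_div (by linarith)).mpr hck
    have hg1 : 1 ≤ g := Nat.le_floor (by simpa using hkc)
    have hg1R : (1 : ℝ) ≤ g := by exact_mod_cast hg1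
    have hgle : (g : ℝ) ≤ k / c := Nat.floor_le (by linarith)
    have hglt : k / c < g + 1 := Nat.lt_floor_add_one _
    have hgk : (g : ℝ) ≤ 2 * q := (hgle.trans (div_le_self (by linarith) hc1)).trans hkq
    have hQ : ((C ^ g : ℕ) : ℝ) ≤ 2 * q := by
      push_cast
      rw [← h2k, ← h2c, ← Real.rpow_natCast, ← Real.rpow_mul two_pos.le]
      refine Real.rpow_le_rpow_of_exponent_le (by norm_num) ?_
      rw [le_div_iff₀ (by linarith)] at hgle
      linarith
    set P := ⌈D / g⌉₊ with hP
    have hDg : D / g ≤ 2 * (D / k * c) := by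
      rw [div_le_iff₀ (by linarith)]
      rw [div_lt_iff₀ (by linarith)] at hglt
      have h1 : k ≤ 2 * g * c := by nlinarith
      have h2 : 2 * (D / k * c) * g = D / k * (2 * g * c) := by ring
      rw [h2]
      calc D = D / k * k := by field_simp
        _ ≤ _ := mul_le_mul_of_nonneg_left h1 (by positivity)
    have hPlt : (P : ℝ) < D / g + 1 := Nat.ceil_lt_add_one (by positivity)
    have hPle : (P : ℝ) ≤ 2 * (D / k * c) + 1 := by linarith
    have hPg : D ≤ P * g := by
      have := Nat.le_ceil (D / g)
      rwa [div_le_iff₀ (by linarith)] at this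
    have hPg' : (P : ℝ) * g ≤ 3 * x := by
      have h1 : (P : ℝ) * g ≤ (D / g + 1) * g := mul_le_mul_of_nonneg_right hPlt.le (by linarith)
      have h2 : (D / g + 1) * g = D + g := by field_simp
      linarith
    have hP0 : 0 < P := Nat.ceil_pos.mpr (by positivity)
    refine ⟨⌈6 * x⌉₊ :: P * g :: (List.replicate P (C ^ g + C ^ g) ++ [C ^ g * g]), ?_, ?_, ?_⟩
    · simp only [List.length_cons, List.length_append, List.length_replicate, List.length_nil]
      push_cast
      linarith
    · simp only [List.sum_cons, List.sum_append, List.sum_replicate, List.sum_nil, smul_eq_mul]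
      have h1 : (P : ℝ) * ((C ^ g : ℕ) : ℝ) ≤ (2 * (D / k * c) + 1) * (2 * q) :=
        mul_le_mul hPle hQ (Nat.cast_nonneg _) (by linarith)
      have h2 : ((C ^ g : ℕ) : ℝ) * g ≤ 2 * q * (2 * q) :=
        mul_le_mul hQ hgk (by linarith) (by linarith)
      have h3 : D / k * c * q ≤ D * c * q := mul_le_mul_of_nonneg_right hDck (by linarith)
      have h4 : 0 ≤ D * c * q := by positivity
      generalize C ^ g = Q at *
      push_cast
      linarith
    · intro ι _ z y hz hz₀ hzlt hy
      refine hz.stepChain_grouped hz₀ hP0 hg1 (by positivity) (by omega) (fun i => ?_) le_rfl hy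
      refine (hzlt i).trans_le ?_
      push_cast
      rw [← mul_assoc 6]
      exact mul_le_mul hA' hPg (by linarith) (by linarith)
  · set Q := ⌈2 * q⌉₊ with hQdef
    set h := ⌈c / k⌉₊ with hh
    set P := ⌈D⌉₊ with hP
    have hQle : (Q : ℝ) ≤ 3 * q := by
      linarith [Nat.ceil_lt_add_one (show 0 ≤ 2 * q by linarith)]
    have hQge : 2 * q ≤ Q := Nat.le_ceil _
    have hck1 : 1 ≤ c / k := (one_le_div (by linarith)).mpr hck.le
    have hhle : (h : ℝ) ≤ 2 * (c / k) := by
      linarith [Nat.ceil_lt_add_one (show 0 ≤ c / k by linarith)]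
    have hhge : c / k ≤ h := Nat.le_ceil _
    have hPle : (P : ℝ) ≤ 2 * D := by
      linarith [Nat.ceil_lt_add_one (show 0 ≤ D by linarith)]
    have hPge : D ≤ P := Nat.le_ceil _
    have hP0 : 0 < P := Nat.ceil_pos.mpr (by linarith)
    have hh0 : 0 < h := Nat.ceil_pos.mpr (by linarith)
    have hQ0 : 0 < Q := Nat.ceil_pos.mpr (by linarith)
    have hPh : (P : ℝ) * h ≤ 4 * (D / k * c) := by
      calc (P : ℝ) * h ≤ 2 * D * (2 * (c / k)) :=
            mul_le_mul hPle hhle (Nat.cast_nonneg _) (by linarith)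
        _ = _ := by ring
    refine ⟨⌈6 * x⌉₊ :: P :: List.replicate (P * h) (Q + Q), ?_, ?_, ?_⟩
    · simp only [List.length_cons, List.length_replicate]
      push_cast
      linarith
    · simp only [List.sum_cons, List.sum_replicate, smul_eq_mul]
      have h1 : (P : ℝ) * h * Q ≤ 4 * (D / k * c) * (3 * q) :=
        mul_le_mul hPh hQle (Nat.cast_nonneg _) (by linarith)
      have h3 : D / k * c * q ≤ D * c * q := mul_le_mul_of_nonneg_right hDck (by linarith)
      push_cast
      linarith
    · intro ι _ z y hz hz₀ hzlt hy
      refine hz.stepChain_direct hz₀ hP0 hh0 hQ0 (by omega) (fun i => ?_) ?_ hy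
      · refine (hzlt i).trans_le ?_
        rw [← mul_assoc 6]
        exact mul_le_mul hA' hPge (by linarith) (by linarith)
      · have : (C : ℝ) ≤ (Q : ℝ) ^ h := by
          calc (C : ℝ) = 2 ^ c := h2c.symm
            _ ≤ 2 ^ (k * h) := by
              refine Real.rpow_le_rpow_of_exponent_le (by norm_num) ?_
              rw [div_le_iff₀ (by linarith)] at hhge
              linarith
            _ = (2 * q) ^ h := by rw [Real.rpow_mul two_pos.le, h2k, Real.rpow_natCast]
            _ ≤ _ := pow_le_pow_left₀ (by linarith) hQge _
        exact_mod_cast this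

theorem exists_architecture {N C dx : ℕ} (hN : 2 ≤ N) (hC : 2 ≤ C) (hdx : 1 ≤ dx) {w : ℝ}
    (hw : w ∈ Set.Icc (2 / 3 : ℝ) 1) {Δ : ℝ} (hΔ : 1 ≤ Δ) {σ : ℝ → ℝ}
    (hσ : IsSigmoidal σ ∨ σ = relu) :
    ∃ es : List ℕ,
      (es.length : ℝ) ≤ 6 + 2 * Real.logb 2 dx + Real.logb 2 Δ +
        4 * ((N : ℝ) ^ (2 - 2 * w) / (1 + (1.5 * w - 1) * Real.logb 2 N) * Real.logb 2 C) ∧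
      (es.sum : ℝ) ≤ 1 + 2 * Real.logb 2 dx + Real.logb 2 Δ + 31 * (N : ℝ) ^ w +
        24 * ((N : ℝ) ^ (1 - w / 2) * Real.logb 2 C) ∧
      ∀ X : Finset (EuclideanSpace ℝ (Fin dx)), X.card = N →
        IsSeparated Δ (X : Set (EuclideanSpace ℝ (Fin dx))) →
        ∀ y : X → Fin C, CanMemorize σ dx (chainArchitecture es) X y := by
  obtain ⟨es, hlen, hsum, hchain⟩ := exists_lookup_chain hN hC hw
  obtain ⟨hw1, hw2⟩ := hw
  have hNR : (2 : ℝ) ≤ N := by exact_mod_cast hN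
  have hN1 : (1 : ℝ) ≤ N := by linarith
  have hN0 : (0 : ℝ) < N := by linarith
  have hdxR : (1 : ℝ) ≤ dx := by exact_mod_cast hdx
  have hx1 : 1 ≤ (N : ℝ) ^ w := Real.one_le_rpow hN1 (by linarith)
  have hn1 : 1 ≤ (N : ℝ) ^ (1 - w) := Real.one_le_rpow hN1 (by linarith)
  have hℓ1 : 1 ≤ (N : ℝ) ^ (2 - w) := Real.one_le_rpow hN1 (by linarith)
  have hnx : (N : ℝ) ^ (1 - w) * (N : ℝ) ^ w = N := by
    rw [← Real.rpow_add hN0, sub_add_cancel, Real.rpow_one]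
  have hℓx : (N : ℝ) ^ (2 - w) * (N : ℝ) ^ w = (N : ℝ) ^ 2 := by
    rw [← Real.rpow_add hN0, sub_add_cancel, Real.rpow_two]
  have hnN : (N : ℝ) ^ (1 - w) * N = (N : ℝ) ^ (2 - w) := by
    rw [← Real.rpow_add_one hN0.ne']
    congr 1
    ring
  set L := ⌈Real.logb 2 ((dx : ℝ) ^ 2 * Δ)⌉₊ with hLdef
  have hlogd : 0 ≤ Real.logb 2 (dx : ℝ) := Real.logb_nonneg (by norm_num) hdxR
  have hlogΔ : 0 ≤ Real.logb 2 Δ := Real.logb_nonneg (by norm_num) hΔ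
  have hlog : Real.logb 2 ((dx : ℝ) ^ 2 * Δ) = 2 * Real.logb 2 dx + Real.logb 2 Δ := by
    rw [Real.logb_mul (by positivity) (by positivity), Real.logb_pow]
    push_cast
    rfl
  have hLle : (L : ℝ) ≤ 1 + 2 * Real.logb 2 dx + Real.logb 2 Δ := by
    have := Nat.ceil_lt_add_one (show 0 ≤ Real.logb 2 ((dx : ℝ) ^ 2 * Δ) by rw [hlog]; linarith)
    linarith
  have hL : (dx : ℝ) ^ 2 * Δ ≤ 2 ^ L := by
    calc (dx : ℝ) ^ 2 * Δ = 2 ^ Real.logb 2 ((dx : ℝ) ^ 2 * Δ) :=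
          (two_rpow_logb (by positivity)).symm
      _ ≤ 2 ^ (L : ℝ) := Real.rpow_le_rpow_of_exponent_le (by norm_num) (Nat.le_ceil _)
      _ = _ := Real.rpow_natCast _ _
  set n := ⌈(N : ℝ) ^ (1 - w)⌉₊ with hndef
  have hn : 0 < n := Nat.ceil_pos.mpr (by linarith)
  have hnge : (N : ℝ) ^ (1 - w) ≤ n := Nat.le_ceil _
  have hnle : (n : ℝ) ≤ 2 * (N : ℝ) ^ (1 - w) := by
    linarith [Nat.ceil_lt_add_one (show 0 ≤ (N : ℝ) ^ (1 - w) by linarith)]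
  set J₁ := ⌈10 * (N : ℝ) ^ w⌉₊ with hJ₁def
  set J₂ := ⌈(N : ℝ) ^ w⌉₊ with hJ₂def
  have hJ₁le : (J₁ : ℝ) ≤ 11 * (N : ℝ) ^ w := by
    linarith [Nat.ceil_lt_add_one (show 0 ≤ 10 * (N : ℝ) ^ w by linarith)]
  have hJ₂le : (J₂ : ℝ) ≤ 2 * (N : ℝ) ^ w := by
    linarith [Nat.ceil_lt_add_one (show 0 ≤ (N : ℝ) ^ w by linarith)]
  have hJ₁ge : 10 * (N : ℝ) ^ w ≤ J₁ := Nat.le_ceil _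
  have hJ₂ge : (N : ℝ) ^ w ≤ J₂ := Nat.le_ceil _
  refine ⟨List.replicate L 1 ++ (J₁ + J₂) :: es, ?_, ?_, fun X hX hsep y => ?_⟩
  · simp only [List.length_append, List.length_replicate, List.length_cons]
    push_cast
    linarith
  · simp only [List.sum_append, List.sum_replicate, List.sum_cons, smul_eq_mul, mul_one]
    generalize es.sum = s at *
    push_cast
    linarith
  -- With `ℓ = N^(2-w)` and `n ≈ N^(1-w)`, both partitions have `O(N^w)` classes, and `S = 2 n N +
  -- 1` gives `ℓ + S ≤ 6 N^(2-w)`.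
  · refine canMemorize_of_stepChain hσ hdx (by omega) hΔ hsep hL (ℓ := (N : ℝ) ^ (2 - w))
      (by linarith) ?_ hn ?_ (S := 2 * n * N + 1) (by rw [hX]; omega) fun z hz hz₀ hzlt => ?_
    · rw [hX, ← hℓx]
      nlinarith
    · rw [hX]
      have : (N : ℝ) ≤ n * (J₂ + 1) := by
        calc (N : ℝ) = (N : ℝ) ^ (1 - w) * (N : ℝ) ^ w := hnx.symm
          _ ≤ _ := mul_le_mul hnge (by linarith) (by linarith) (Nat.cast_nonneg _)
      exact_mod_cast this
    · refine hchain z (fun i => (y i : ℕ)) hz hz₀ (fun i => (hzlt i).trans_le ?_) fun i => (y i).2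
      push_cast
      nlinarith

theorem theorem1 :
    ∃ K : ℝ, 0 < K ∧
      ∀ (σ : ℝ → ℝ), (IsSigmoidal σ ∨ σ = relu) →
      ∀ (C N dx : ℕ), 1 ≤ C → 1 ≤ N → 1 ≤ dx →
      ∀ (w : ℝ), w ∈ Set.Icc (2 / 3 : ℝ) 1 →
      ∀ (Δ : ℝ), 1 ≤ Δ →
        ∃ ds : List ℕ, (∀ d ∈ ds, 1 ≤ d) ∧
          (ds.length : ℝ) ≤ K * (Real.logb 2 (dx : ℝ) + Real.logb 2 Δ +
            (N : ℝ) ^ (2 - 2 * w) / (1 + (1.5 * w - 1) * Real.logb 2 (N : ℝ)) *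
              Real.logb 2 (C : ℝ)) ∧
          (numParams dx ds : ℝ) ≤ K * ((dx : ℝ) + Real.logb 2 Δ + (N : ℝ) ^ w +
            (N : ℝ) ^ (1 - w / 2) * Real.logb 2 (C : ℝ)) ∧
          ∀ (X : Finset (EuclideanSpace ℝ (Fin dx))), X.card = N →
            IsSeparated Δ (X : Set (EuclideanSpace ℝ (Fin dx))) →
            ∀ y : X → Fin C, CanMemorize σ dx ds X y := by
  refine ⟨1000, by norm_num, fun σ hσ C N dx hC hN hdx w hw Δ hΔ => ?_⟩
  have hNR : (1 : ℝ) ≤ N := by exact_mod_cast hN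
  have hN0 : (0 : ℝ) < N := by linarith
  have hCR : (1 : ℝ) ≤ C := by exact_mod_cast hC
  have hdxR : (1 : ℝ) ≤ dx := by exact_mod_cast hdx
  have hlogd : 0 ≤ Real.logb 2 (dx : ℝ) := Real.logb_nonneg (by norm_num) hdxR
  have hlogΔ : 0 ≤ Real.logb 2 Δ := Real.logb_nonneg (by norm_num) hΔ
  have hlogC : 0 ≤ Real.logb 2 (C : ℝ) := Real.logb_nonneg (by norm_num) hCR
  have hlogN : 0 ≤ Real.logb 2 (N : ℝ) := Real.logb_nonneg (by norm_num) hNR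
  have hk1 : 1 ≤ 1 + (1.5 * w - 1) * Real.logb 2 (N : ℝ) := by
    have : 0 ≤ (1.5 * w - 1) * Real.logb 2 (N : ℝ) := mul_nonneg (by linarith [hw.1]) hlogN
    linarith
  have hx1 : 1 ≤ (N : ℝ) ^ w := Real.one_le_rpow hNR (by linarith [hw.1])
  have hR0 : 0 ≤ (N : ℝ) ^ (2 - 2 * w) / (1 + (1.5 * w - 1) * Real.logb 2 (N : ℝ)) *
      Real.logb 2 (C : ℝ) := by positivity
  have hM0 : 0 ≤ (N : ℝ) ^ (1 - w / 2) * Real.logb 2 (C : ℝ) := by positivity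
  -- If only constant labellings occur, no hidden layer is used, so the bounds may vanish. Otherwise
  -- `N, C ≥ 2`, and the bracket in the depth bound is at least `1/2`, which absorbs the additive
  -- constants.
  by_cases htriv : ∀ X : Finset (EuclideanSpace ℝ (Fin dx)), X.card = N →
      IsSeparated Δ (X : Set (EuclideanSpace ℝ (Fin dx))) → ∀ y : X → Fin C, ∀ x x', y x = y x'
  · refine ⟨[], by simp, ?_, ?_, fun X hX hsep y => canMemorize_of_constant σ (htriv X hX hsep y)⟩
    · rw [List.length_nil, Nat.cast_zero]
      positivity
    · simp only [numParams]
      push_cast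
      linarith
  push Not at htriv
  obtain ⟨X₀, hX₀, hsep₀, y₀, x, x', hxx'⟩ := htriv
  have hC2 : 2 ≤ C := by
    by_contra hcon
    exact hxx' (Fin.ext (by omega))
  have hN2 : 2 ≤ N := by
    rw [← hX₀]
    exact Finset.one_lt_card.mpr ⟨x, x.2, x', x'.2, fun h => hxx' (by rw [Subtype.ext h])⟩
  have hone : 1 / 2 ≤ Real.logb 2 (dx : ℝ) + Real.logb 2 Δ +
      (N : ℝ) ^ (2 - 2 * w) / (1 + (1.5 * w - 1) * Real.logb 2 (N : ℝ)) *
        Real.logb 2 (C : ℝ) := by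
    have hlog2 : ∀ a : ℝ, 2 ≤ a → 1 ≤ Real.logb 2 a := fun a ha => by
      rw [Real.le_logb_iff_rpow_le (by norm_num) (by linarith)]
      simpa using ha
    rcases Nat.lt_or_ge 1 dx with h | h
    · linarith [hlog2 dx (by exact_mod_cast h)]
    rcases Nat.lt_or_ge 2 N with h' | h'
    · have hΔ2 : 2 ≤ Δ := by
        obtain rfl : dx = 1 := by omega
        exact hsep₀.two_le_of_dim_one (by omega)
      linarith [hlog2 Δ hΔ2]
    have h1 := hlog2 C (by exact_mod_cast hC2)
    have h2 : (1 : ℝ) ≤ (N : ℝ) ^ (2 - 2 * w) := Real.one_le_rpow hNR (by linarith [hw.2])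
    have h3 : 1 + (1.5 * w - 1) * Real.logb 2 (N : ℝ) ≤ 2 := by
      rw [show N = 2 by omega, Nat.cast_ofNat, Real.logb_self_eq_one (by norm_num)]
      linarith [hw.2]
    have h4 : 1 / 2 ≤ (N : ℝ) ^ (2 - 2 * w) / (1 + (1.5 * w - 1) * Real.logb 2 (N : ℝ)) := by
      rw [div_le_div_iff₀ two_pos (by linarith)]
      linarith
    nlinarith
  obtain ⟨es, hlen, hsum, hmem⟩ := exists_architecture hN2 hC2 hdx hw hΔ hσ
  refine ⟨chainArchitecture es, fun d hd => one_le_of_mem_chainArchitecture hd, ?_, ?_, hmem⟩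
  · rw [length_chainArchitecture]
    push_cast
    linarith
  · rw [numParams_chainArchitecture]
    generalize es.sum = s at *
    push_cast
    have hlogd' : Real.logb 2 (dx : ℝ) ≤ dx := by
      rw [Real.logb_le_iff_le_rpow (by norm_num) (by linarith), Real.rpow_natCast]
      exact_mod_cast Nat.lt_two_pow_self.le
    have hRM : (N : ℝ) ^ (2 - 2 * w) / (1 + (1.5 * w - 1) * Real.logb 2 (N : ℝ)) *
        Real.logb 2 (C : ℝ) ≤ (N : ℝ) ^ (1 - w / 2) * Real.logb 2 (C : ℝ) := by
      refine mul_le_mul_of_nonneg_right ((div_le_self (by positivity) hk1).trans ?_) hlogC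
      exact Real.rpow_le_rpow_of_exponent_le hNR (by linarith [hw.1])
    linarith
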